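/- Let $D=\{z\in\mathbb C:|z|<1\}$ and, for $0\le r<1$, let $\Phi_r(\theta)=\dfrac{1-r^2}{2\pi(1-2r\cos\theta+r^2)}$ be the Poisson kernel. Let $\mathcal{HK}$ be the set of $2\pi$-periodic functions $f:\mathbb R\to\mathbb R$ that are Henstock–Kurzweil integrable over $[-\pi,\pi]$. For $f\in\mathcal{HK}$, $0\le r<1$ and $\theta\in\mathbb R$ the Henstock–Kurzweil integral $$u_r(\theta)=P[f](re^{i\theta}):=\int_{-\pi}^{\pi}f(\phi)\,\Phi_r(\phi-\theta)\,d\phi$$ exists. Write $\|\cdot\|_p$ for the norm of $L^p(-\pi,\pi)$. For functions on $D$, "$o(\cdot)$ as $r\to1$" is understood uniformly in $\theta$ (where $z=re^{i\theta}$), that is, as $|z|\to1^-$ with unrestricted approach to the boundary. (a) For every $f\in\mathcal{HK}$, $\sup_{\theta\in[-\pi,\pi]}|P[f](re^{i\theta})|$ is finite for each $0\le r<1$ and is $o(1/(1-r))$ as $r\to1^-$. This is sharp: for every $\psi:D\to(0,\infty)$ with $\psi(re^{i\theta})=o(1/(1-r))$ as $r\to1^-$ there is $f\in\mathcal{HK}$,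 which can moreover be taken Lebesgue integrable on $[-\pi,\pi]$, such that $P[f]\ne o(\psi)$ as $r\to1^-$. (b) Let $1\le p<\infty$. For every $f\in\mathcal{HK}$, $u_r\in L^p(-\pi,\pi)$ for each $0\le r<1$, and $\|u_r\|_p=o(1/(1-r))$ as $r\to1^-$. This is sharp: for every $\psi:[0,1)\to(0,\infty)$ with $\psi(r)=o(1/(1-r))$ as $r\to1^-$ there is $f\in\mathcal{HK}$ such that $\|u_r\|_p\ne o(\psi(r))$ as $r\to1^-$. -/

import Mathlib

open Real Set Filter Topology MeasureTheory
open scoped Asymptotics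

namespace HKPoisson

/-- The interval `[-π, π]`, as a box in dimension one. -/
noncomputable def period : BoxIntegral.Box (Fin 1) where
  lower := fun _ => -π
  upper := fun _ => π
  lower_lt_upper := fun _ => by linarith [Real.pi_pos]

/-- Henstock–Kurzweil integrability of `g` over `[-π, π]`, with respect to length
(for every `ε > 0` there is a gauge `δ > 0` such that all tagged partitions that are finer than `δ`
and have each tag in its own interval have Riemann sums `ε`-close to one number). -/
def HKIntegrable (g : ℝ → ℝ) : Prop :=
  BoxIntegral.Integrable period BoxIntegral.IntegrationParams.Henstock
    (fun x : Fin 1 → ℝ => g (x 0)) (volume : Measure (Fin 1 → ℝ)).toBoxAdditive.toSMul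

/-- The Henstock–Kurzweil integral of `g` over `[-π, π]`. -/
noncomputable def hkIntegral (g : ℝ → ℝ) : ℝ :=
  BoxIntegral.integral period BoxIntegral.IntegrationParams.Henstock
    (fun x : Fin 1 → ℝ => g (x 0)) (volume : Measure (Fin 1 → ℝ)).toBoxAdditive.toSMul

/-- The space of `2π`-periodic functions `ℝ → ℝ` that are Henstock–Kurzweil integrable
over a period. -/
def HK : Set (ℝ → ℝ) := {f | Function.Periodic f (2 * π) ∧ HKIntegrable f}

/-- The Poisson kernel `Φ_r(θ)`. -/
noncomputable def kernel (r θ : ℝ) : ℝ :=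
  (1 - r ^ 2) / (2 * π * (1 - 2 * r * cos θ + r ^ 2))

/-- The Poisson integral in polar coordinates: `poisson f r θ = u_r(θ) = P[f](r e^{iθ})`. -/
noncomputable def poisson (f : ℝ → ℝ) (r θ : ℝ) : ℝ :=
  hkIntegral (fun φ => f φ * kernel r (φ - θ))

/-- Lebesgue measure on one period. -/
noncomputable def circleMeasure : Measure ℝ := volume.restrict (Ioc (-π) π)

end HKPoisson

/-! A Henstock–Kurzweil integrable `f` has a continuous primitive `F`, and its product with a C¹
function can be integrated by parts (`exists_hasHK_mul`). Hence P[f] is a boundary term minus ∫ F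
Φ_r', the quantity `poissonDeriv F`, and only the continuous function `F` matters. Over a period Φ_r
rises to one peak and falls again, so its supremum and its total variation are both O(1/(1-r)); this
bounds |P[f]| by a constant times sup|F|/(1-r). Approximating `F` uniformly by a polynomial turns O
into o, because the Poisson integral of a polynomial's derivative stays bounded. The Lᵖ estimate
follows since the period has finite measure.

Sharpness in (a): place mass 2⁻ᵏ on (0, w_k]. At radius 1 - w_k the kernel is at least 1/(4π w_k)
there, so P[f](1 - w_k) is at least a constant times 2⁻ᵏ/w_k, and w_k can be chosen with ψ(1 - w_k)
≤ 2⁻ᵏ/w_k.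

Sharpness in (b): Lebesgue integrable functions cannot serve for p = 1, as their ‖u_r‖₁ stays
bounded. Instead f = F' with F the sum of the waves 8⁻ᵏ sin(n_k x) on [0, π/2ᵏ]. The supports shrink
to 0, so F is differentiable off a countable set. With 2ᵏ dividing n_k, the waves vanish at the ends
of their supports and the earlier ones are orthogonal to sin(n_j x). The cosine moment of u_r of
order n_j is then at least n_j r^(n_j) 16⁻ʲ; at r = 1 - 1/(2n_j) it exceeds a multiple of ψ(r) for
suitable n_j, and it is bounded by a constant times ‖u_r‖_p. -/

namespace HKPoisson

/-! ### One-dimensional boxes and increments -/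

/-- The interval `(a, b]` as a one-dimensional box. -/
def intervalBox (a b : ℝ) (h : a < b) : BoxIntegral.Box (Fin 1) where
  lower := fun _ => a
  upper := fun _ => b
  lower_lt_upper := fun _ => h

lemma intervalBox_eq (J : BoxIntegral.Box (Fin 1)) :
    intervalBox (J.lower 0) (J.upper 0) (J.lower_lt_upper 0) = J := by
  cases J with
  | mk l u h =>
    simp only [intervalBox, BoxIntegral.Box.mk.injEq]
    constructor <;> (ext i; fin_cases i; rfl)

lemma mem_Icc_iff {J : BoxIntegral.Box (Fin 1)} {x : Fin 1 → ℝ} :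
    x ∈ BoxIntegral.Box.Icc J ↔ x 0 ∈ Icc (J.lower 0) (J.upper 0) := by
  simp [BoxIntegral.Box.Icc_def, Pi.le_def]

lemma intervalBox_le_period {a b : ℝ} (h : a < b) :
    intervalBox a b h ≤ period ↔ -π ≤ a ∧ b ≤ π := by
  simp [BoxIntegral.Box.le_iff_bounds, intervalBox, period, Pi.le_def]

lemma le_period_iff {J : BoxIntegral.Box (Fin 1)} :
    J ≤ period ↔ -π ≤ J.lower 0 ∧ J.upper 0 ≤ π := by
  simp [BoxIntegral.Box.le_iff_bounds, period, Pi.le_def]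

lemma splitLower_intervalBox {a b x : ℝ} (h : a < b) (hx : x ∈ Ioo a b) :
    (intervalBox a b h).splitLower 0 x = (intervalBox a x hx.1 : WithBot _) := by
  rw [BoxIntegral.Box.splitLower_def (i := (0 : Fin 1)) (by simpa [intervalBox] using hx)]
  congr 1
  simp only [intervalBox, BoxIntegral.Box.mk.injEq, true_and]
  ext i; fin_cases i; simp

lemma splitUpper_intervalBox {a b x : ℝ} (h : a < b) (hx : x ∈ Ioo a b) :
    (intervalBox a b h).splitUpper 0 x = (intervalBox x b hx.2 : WithBot _) := by
  rw [BoxIntegral.Box.splitUpper_def (i := (0 : Fin 1)) (by simpa [intervalBox] using hx)]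
  congr 1
  simp only [intervalBox, BoxIntegral.Box.mk.injEq, and_true]
  ext i; fin_cases i; simp

/-- The increment of a function of one variable, as a box-additive function. -/
noncomputable def increment (H : ℝ → ℝ) (I : WithTop (BoxIntegral.Box (Fin 1))) :
    BoxIntegral.BoxAdditiveMap (Fin 1) ℝ I :=
  BoxIntegral.BoxAdditiveMap.ofMapSplitAdd (fun J => H (J.upper 0) - H (J.lower 0)) I <| by
    intro J _ i x hx
    obtain rfl : i = 0 := Subsingleton.elim _ _
    rw [← intervalBox_eq J, splitLower_intervalBox _ hx, splitUpper_intervalBox _ hx]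
    simp only [intervalBox]
    change (H x - H _) + (H _ - H x) = _
    ring

lemma increment_apply (H : ℝ → ℝ) (I : WithTop (BoxIntegral.Box (Fin 1)))
    (J : BoxIntegral.Box (Fin 1)) : increment H I J = H (J.upper 0) - H (J.lower 0) := rfl

/-- The length of one-dimensional boxes, acting on reals by multiplication. -/
noncomputable abbrev lengthMap : BoxIntegral.BoxAdditiveMap (Fin 1) (ℝ →L[ℝ] ℝ) ⊤ :=
  (volume : Measure (Fin 1 → ℝ)).toBoxAdditive.toSMul

lemma lengthMap_apply (J : BoxIntegral.Box (Fin 1)) (c : ℝ) :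
    lengthMap J c = (J.upper 0 - J.lower 0) * c := by
  rw [BoxIntegral.BoxAdditiveMap.toSMul_apply, BoxIntegral.Box.volume_apply]
  simp

lemma len_pos (J : BoxIntegral.Box (Fin 1)) : 0 < J.upper 0 - J.lower 0 :=
  sub_pos.2 (J.lower_lt_upper 0)

/-- `g` has Henstock–Kurzweil integral `y` over `[-π, π]`. -/
abbrev HasHK (g : ℝ → ℝ) (y : ℝ) : Prop :=
  BoxIntegral.HasIntegral period BoxIntegral.IntegrationParams.Henstock
    (fun x : Fin 1 → ℝ => g (x 0)) lengthMap y

lemma HasHK.integrable {g : ℝ → ℝ} {y : ℝ} (h : HasHK g y) : HKIntegrable g := ⟨y, h⟩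

lemma HasHK.integral_eq {g : ℝ → ℝ} {y : ℝ} (h : HasHK g y) : hkIntegral g = y :=
  BoxIntegral.HasIntegral.integral_eq h

/-! ### The fundamental theorem of calculus -/

/-- The fundamental theorem of calculus for the Henstock–Kurzweil integral, with a countable set
of exceptions. -/
theorem hasHK_of_hasDerivAt {F f : ℝ → ℝ} (hF : Continuous F) {s : Set ℝ} (hs : s.Countable)
    (hd : ∀ x ∉ s, HasDerivAt F (f x) x) : HasHK f (F π - F (-π)) := by
  have key := BoxIntegral.HasIntegral.of_bRiemann_eq_false_of_forall_isLittleO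
    (l := BoxIntegral.IntegrationParams.Henstock) (I := period)
    (f := fun x : Fin 1 → ℝ => f (x 0)) (vol := lengthMap) rfl
    (increment id period) (fun J => by
      rw [increment_apply]; exact (len_pos J).le) (increment F period)
    ((fun x : Fin 1 → ℝ => x 0) ⁻¹' s)
    (hs.preimage fun x y h => by ext i; fin_cases i; exact h) (fun _ => rfl) ?_ ?_
  · exact key
  -- At an exceptional point continuity suffices: the error need only be at most ε, not ε times the
  -- length. The second entry of the gauge makes length times |f x| at most ε/2.
  · rintro c x ⟨-, hx⟩ ε hε
    have h1 : Tendsto (fun y => F y - F (x 0)) (𝓝 (x 0)) (𝓝 0) := by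
      have := (hF.tendsto (x 0)).sub_const (F (x 0))
      simpa using this
    obtain ⟨δ, hδ, H⟩ := Metric.tendsto_nhds_nhds.1 h1 (ε / 4) (by positivity)
    refine ⟨min (δ / 2) (ε / (4 * (|f (x 0)| + 1))), by positivity, fun J _ hsub hxJ _ => ?_⟩
    have hu := hsub (a := J.upper) J.upper_mem_Icc
    have hl := hsub (a := J.lower) J.lower_mem_Icc
    rw [mem_closedBall_iff_norm] at hu hl
    have hu' : |J.upper 0 - x 0| ≤ _ := (norm_le_pi_norm (J.upper - x) 0).trans hu
    have hl' : |J.lower 0 - x 0| ≤ _ := (norm_le_pi_norm (J.lower - x) 0).trans hl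
    have e1 := H (x := J.upper 0) (by
      rw [Real.dist_eq]; linarith [hu'.trans (min_le_left _ _)])
    have e2 := H (x := J.lower 0) (by
      rw [Real.dist_eq]; linarith [hl'.trans (min_le_left _ _)])
    have e3 := hu'.trans (min_le_right _ _)
    have e4 := hl'.trans (min_le_right _ _)
    rw [le_div_iff₀ (by positivity)] at e3 e4
    rw [lengthMap_apply, increment_apply, Real.dist_eq]
    rw [Real.dist_eq, sub_zero] at e1 e2
    have hA : |(J.upper 0 - J.lower 0) * f (x 0)| ≤ ε / 2 := by
      rw [abs_mul]
      have : |J.upper 0 - J.lower 0| ≤ |J.upper 0 - x 0| + |J.lower 0 - x 0| := by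
        have := abs_sub (J.upper 0 - x 0) (J.lower 0 - x 0)
        simpa using this
      nlinarith [abs_nonneg (f (x 0)), abs_nonneg (J.upper 0 - x 0), abs_nonneg (J.lower 0 - x 0)]
    rw [abs_le] at hA ⊢
    rw [abs_lt] at e1 e2
    constructor <;> linarith [hA.1, hA.2, e1.1, e1.2, e2.1, e2.2]
  -- Elsewhere the tag lies in its own interval, so the two one-sided errors ε|u - x| and ε|x - l|
  -- add up to ε times the length.
  · rintro c x ⟨-, hx⟩ ε hε
    have h1 := (hd (x 0) hx).isLittleO.def hε
    obtain ⟨δ, hδ, H⟩ := Metric.eventually_nhds_iff.1 h1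
    refine ⟨δ / 2, by positivity, fun J _ hsub hxJ _ => ?_⟩
    have hu := hsub (a := J.upper) J.upper_mem_Icc
    have hl := hsub (a := J.lower) J.lower_mem_Icc
    rw [mem_closedBall_iff_norm] at hu hl
    have hu' : |J.upper 0 - x 0| ≤ _ := (norm_le_pi_norm (J.upper - x) 0).trans hu
    have hl' : |J.lower 0 - x 0| ≤ _ := (norm_le_pi_norm (J.lower - x) 0).trans hl
    have e1 := H (y := J.upper 0) (by rw [Real.dist_eq]; linarith)
    have e2 := H (y := J.lower 0) (by rw [Real.dist_eq]; linarith)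
    have hx' := mem_Icc_iff.1 (hxJ rfl)
    simp only [Real.norm_eq_abs, smul_eq_mul] at e1 e2
    rw [abs_of_nonneg (sub_nonneg.2 hx'.2), abs_le] at e1
    rw [abs_of_nonpos (sub_nonpos.2 hx'.1), abs_le] at e2
    rw [lengthMap_apply, increment_apply, increment_apply, Real.dist_eq, abs_le]
    simp only [id]
    constructor <;> linarith [e1.1, e1.2, e2.1, e2.2]

/-! ### Primitives and integration by parts -/

/-- The indefinite Henstock–Kurzweil integral on subintervals is the increment of a function. -/
lemma exists_indefinite_integral {f : ℝ → ℝ} (hf : HKIntegrable f) :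
    ∃ F : ℝ → ℝ, ∀ J ≤ period,
      BoxIntegral.integral J BoxIntegral.IntegrationParams.Henstock
        (fun x : Fin 1 → ℝ => f (x 0)) lengthMap = F (J.upper 0) - F (J.lower 0) := by
  classical
  set G := BoxIntegral.Integrable.toBoxAdditive hf with hG
  -- Boxes are nondegenerate, so the value 0 at -π has to be supplied separately.
  refine ⟨fun x => if h : -π < x then G (intervalBox (-π) x h) else 0, fun J hJ => ?_⟩
  obtain ⟨h1, h2⟩ := le_period_iff.1 hJ
  have h3 := J.lower_lt_upper 0
  change G J = _
  simp only [dif_pos (h1.trans_lt h3)]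
  rcases h1.eq_or_lt with h | h
  · rw [dif_neg (by linarith), sub_zero]
    congr 1
    conv_lhs => rw [← intervalBox_eq J]
    congr 1
    exact h.symm
  · rw [dif_pos h]
    have := G.map_split_add (I := intervalBox (-π) (J.upper 0) (h.trans h3))
      (WithTop.coe_le_coe.2 ((intervalBox_le_period _).2 ⟨le_rfl, h2⟩)) 0 (J.lower 0)
    rw [splitLower_intervalBox _ ⟨h, h3⟩, splitUpper_intervalBox _ ⟨h, h3⟩] at this
    rw [← this]
    change G J = G _ + G _ - G _
    rw [intervalBox_eq]
    ring

/-- The Saks–Henstock inequality with absolute values. -/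
lemma exists_gauge {f F : ℝ → ℝ} (hf : HKIntegrable f)
    (hF : ∀ J ≤ period, BoxIntegral.integral J BoxIntegral.IntegrationParams.Henstock
        (fun x : Fin 1 → ℝ => f (x 0)) lengthMap = F (J.upper 0) - F (J.lower 0))
    {ε : ℝ} (hε : 0 < ε) :
    ∃ r : (Fin 1 → ℝ) → Ioi (0 : ℝ), ∀ P : BoxIntegral.TaggedPrepartition period,
      P.IsSubordinate r → P.IsHenstock →
      ∑ J ∈ P.boxes, |(J.upper 0 - J.lower 0) * f (P.tag J 0)
        - (F (J.upper 0) - F (J.lower 0))| ≤ ε := by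
  classical
  have hf' : BoxIntegral.Integrable period BoxIntegral.IntegrationParams.Henstock
    (fun x : Fin 1 → ℝ => f (x 0)) lengthMap := hf
  -- The distortion bound 0 is a dummy: Henstock partitions carry no distortion condition.
  refine ⟨hf'.convergenceR (ε / 2) 0, fun P hP hH => ?_⟩
  have mem : BoxIntegral.IntegrationParams.Henstock.MemBaseSet period 0
      (hf'.convergenceR (ε / 2) 0) P :=
    ⟨hP, fun _ => hH, fun h => (Bool.false_ne_true h).elim, fun h => (Bool.false_ne_true h).elim⟩
  set d : BoxIntegral.Box (Fin 1) → ℝ := fun J => (J.upper 0 - J.lower 0) * f (P.tag J 0)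
        - (F (J.upper 0) - F (J.lower 0)) with hd
  -- Saks–Henstock bounds the signed error over any subfamily by ε/2. Applied separately to the
  -- nonnegative and the negative errors, it gives ε for the absolute values.
  have main : ∀ (p : BoxIntegral.Box (Fin 1) → Prop) [DecidablePred p],
      |∑ J ∈ P.boxes with p J, d J| ≤ ε / 2 := by
    intro p _
    have := hf'.dist_integralSum_sum_integral_le_of_memBaseSet (half_pos hε) (mem.filter p)
    rw [Real.dist_eq, BoxIntegral.integralSum, ← Finset.sum_sub_distrib] at this
    convert this using 2
    refine Finset.sum_congr ?_ fun J hJ => ?_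
    · ext J
      simp only [Finset.mem_filter]
      exact (P.mem_filter).symm
    · rw [lengthMap_apply, hF J (P.le_of_mem' J (P.mem_filter.1 hJ).1)]
      rfl
  have h1 := main fun J => 0 ≤ d J
  have h2 := main fun J => ¬ 0 ≤ d J
  rw [← Finset.sum_filter_add_sum_filter_not P.boxes fun J => 0 ≤ d J]
  have e1 : ∑ J ∈ P.boxes with 0 ≤ d J, |d J| = ∑ J ∈ P.boxes with 0 ≤ d J, d J :=
    Finset.sum_congr rfl fun J hJ => abs_of_nonneg (Finset.mem_filter.1 hJ).2
  have e2 : ∑ J ∈ P.boxes with ¬ 0 ≤ d J, |d J| = -∑ J ∈ P.boxes with ¬ 0 ≤ d J, d J := by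
    rw [← Finset.sum_neg_distrib]
    exact Finset.sum_congr rfl fun J hJ => abs_of_neg (not_le.1 (Finset.mem_filter.1 hJ).2)
  rw [e1, e2]
  linarith [(abs_le.1 h1).2, (abs_le.1 h2).1]

/-- The indefinite Henstock–Kurzweil integral is continuous. -/
lemma continuousOn_indefinite_integral {f F : ℝ → ℝ} (hf : HKIntegrable f)
    (hF : ∀ J ≤ period, BoxIntegral.integral J BoxIntegral.IntegrationParams.Henstock
        (fun x : Fin 1 → ℝ => f (x 0)) lengthMap = F (J.upper 0) - F (J.lower 0)) :
    ContinuousOn F (Icc (-π) π) := by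
  intro x hx
  rw [Metric.continuousWithinAt_iff]
  intro ε hε
  obtain ⟨r, hr⟩ := exists_gauge hf hF (half_pos hε)
  have hr0 : (0 : ℝ) < r (fun _ => x) := (r (fun _ => x)).2
  -- A single short interval tagged at x is already an admissible prepartition.
  have key : ∀ a b (hab : a < b), -π ≤ a → b ≤ π → x ∈ Icc a b → b - a ≤ r (fun _ => x) →
      |(b - a) * f x - (F b - F a)| ≤ ε / 2 := by
    intro a b hab ha hb hxab hlen
    have hJ := (intervalBox_le_period hab).2 ⟨ha, hb⟩
    have hxI : (fun _ => x) ∈ BoxIntegral.Box.Icc period := mem_Icc_iff.2 hx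
    have := hr (BoxIntegral.TaggedPrepartition.single period (intervalBox a b hab) hJ
      (fun _ => x) hxI) ?_ ?_
    · have e : (BoxIntegral.TaggedPrepartition.single period (intervalBox a b hab) hJ
        (fun _ => x) hxI).boxes = {intervalBox a b hab} := rfl
      rw [e, Finset.sum_singleton] at this
      exact this
    · rw [BoxIntegral.TaggedPrepartition.isSubordinate_single]
      intro y hy
      rw [mem_closedBall_iff_norm, pi_norm_le_iff_of_nonneg hr0.le]
      intro i
      obtain rfl : i = 0 := Subsingleton.elim _ _
      have hy' := mem_Icc_iff.1 hy
      simp only [intervalBox] at hy'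
      rw [Pi.sub_apply, Real.norm_eq_abs, abs_le]
      constructor <;> linarith [hy'.1, hy'.2, hxab.1, hxab.2]
    · rw [BoxIntegral.TaggedPrepartition.isHenstock_single_iff]
      exact mem_Icc_iff.2 hxab
  refine ⟨min (r (fun _ => x)) (ε / (2 * (|f x| + 1))), by positivity, fun y hy hxy => ?_⟩
  rw [Real.dist_eq] at hxy ⊢
  have e1 := (hxy.trans_le (min_le_left _ _)).le
  have e2 := hxy.trans_le (min_le_right _ _)
  rw [lt_div_iff₀ (by positivity)] at e2
  have e3 : |(y - x) * f x| < ε / 2 := by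
    rw [abs_mul]; nlinarith [abs_nonneg (y - x), abs_nonneg (f x), abs_nonneg ((y - x) * f x)]
  rw [abs_lt] at e3 ⊢
  rcases lt_trichotomy x y with h | h | h
  · have := abs_le.1 (key x y h hx.1 hy.2 ⟨le_rfl, h.le⟩ ((le_abs_self _).trans e1))
    constructor <;> linarith [this.1, this.2]
  · subst h; simpa using hε
  · have := abs_le.1 (key y x h hy.1 hx.2 ⟨h.le, le_rfl⟩ (by linarith [neg_abs_le (y - x)]))
    constructor <;> linarith [this.1, this.2]

/-- The left side is one term of a Riemann–Stieltjes sum for ∫ g dF minus its value by parts.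
Centring F at t leaves two products of increments, together at most εM(v - u), and ∫ (F - F t) g',
bounded by the same quantity. -/
lemma stieltjes_local_bound {F g g' : ℝ → ℝ} (hF : Continuous F)
    (hg : ∀ x, HasDerivAt g (g' x) x) (hg' : Continuous g') {u v t ε M : ℝ}
    (hut : u ≤ t) (htv : t ≤ v) (hM : ∀ s ∈ Icc u v, |g' s| ≤ M)
    (hε : ∀ s ∈ Icc u v, |F s - F t| ≤ ε) :
    |g t * (F v - F u) - ((F v * g v - F u * g u) - ∫ s in u..v, F s * g' s)|
      ≤ 2 * ε * M * (v - u) := by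
  have i1 : ∀ a b, IntervalIntegrable g' volume a b := fun a b => hg'.intervalIntegrable a b
  have hFg : Continuous fun s => F s * g' s := hF.mul hg'
  have M0 : 0 ≤ M := (abs_nonneg _).trans (hM t ⟨hut, htv⟩)
  have ε0 : 0 ≤ ε := (abs_nonneg _).trans (hε t ⟨hut, htv⟩)
  have hint : ∀ a b, a ≤ b → u ≤ a → b ≤ v → |g b - g a| ≤ M * (b - a) := by
    intro a b hab ha hb
    rw [← intervalIntegral.integral_eq_sub_of_hasDerivAt (fun x _ => hg x) (i1 a b)]
    have := intervalIntegral.norm_integral_le_of_norm_le_const (a := a) (b := b) (f := g') (C := M)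
      (fun x hx => by
        rw [uIoc_of_le hab] at hx
        exact hM x ⟨ha.trans hx.1.le, hx.2.trans hb⟩)
    rwa [abs_of_nonneg (sub_nonneg.2 hab)] at this
  have e1 := hint t v htv hut le_rfl
  have e2 := hint u t hut le_rfl htv
  have e3 : |∫ s in u..v, (F s - F t) * g' s| ≤ ε * M * (v - u) := by
    have := intervalIntegral.norm_integral_le_of_norm_le_const (a := u) (b := v)
      (f := fun s => (F s - F t) * g' s) (C := ε * M) (fun x hx => by
        rw [uIoc_of_le (hut.trans htv)] at hx
        rw [norm_mul]
        exact mul_le_mul (hε x ⟨hx.1.le, hx.2⟩) (hM x ⟨hx.1.le, hx.2⟩) (abs_nonneg _) ε0)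
    rwa [abs_of_nonneg (by linarith)] at this
  have e4 : ∫ s in u..v, (F s - F t) * g' s = (∫ s in u..v, F s * g' s) - F t * (g v - g u) := by
    rw [← intervalIntegral.integral_eq_sub_of_hasDerivAt (fun x _ => hg x) (i1 u v),
      ← intervalIntegral.integral_const_mul, ← intervalIntegral.integral_sub
        (hFg.intervalIntegrable _ _) ((i1 u v).const_mul _)]
    simp_rw [sub_mul]
  have e5 : g t * (F v - F u) - ((F v * g v - F u * g u) - ∫ s in u..v, F s * g' s)
      = -((F v - F t) * (g v - g t)) - (F u - F t) * (g t - g u)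
        + ∫ s in u..v, (F s - F t) * g' s := by rw [e4]; ring
  have e6 : |(F v - F t) * (g v - g t)| ≤ ε * (M * (v - t)) := by
    rw [abs_mul]; exact mul_le_mul (hε v ⟨hut.trans htv, le_rfl⟩) e1 (abs_nonneg _) ε0
  have e7 : |(F u - F t) * (g t - g u)| ≤ ε * (M * (t - u)) := by
    rw [abs_mul]; exact mul_le_mul (hε u ⟨le_rfl, hut.trans htv⟩) e2 (abs_nonneg _) ε0
  rw [e5]
  rw [abs_le] at e3 e6 e7 ⊢
  constructor <;> nlinarith [e3.1, e3.2, e6.1, e6.2, e7.1, e7.2]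

/-- Integration by parts: a Henstock–Kurzweil integrable function has a continuous primitive, and
its product with a continuously differentiable function is integrable. -/
theorem exists_hasHK_mul {f : ℝ → ℝ} (hf : HKIntegrable f) :
    ∃ F : ℝ → ℝ, Continuous F ∧ ∀ g g' : ℝ → ℝ, (∀ x, HasDerivAt g (g' x) x) → Continuous g' →
      HasHK (fun x => f x * g x) (F π * g π - F (-π) * g (-π) - ∫ x in -π..π, F x * g' x) := by
  have hpi : -π ≤ π := by linarith [pi_pos]
  obtain ⟨F₀, hF₀⟩ := exists_indefinite_integral hf
  have hc := continuousOn_indefinite_integral hf hF₀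
  -- Constant extension beyond the endpoints makes the primitive continuous on all of ℝ.
  set F : ℝ → ℝ := IccExtend hpi ((Icc (-π) π).domRestrict F₀) with hFdef
  have hFc : Continuous F := (continuousOn_iff_continuous_domRestrict.1 hc).Icc_extend'
  have hFe : ∀ x ∈ Icc (-π) π, F x = F₀ x := fun x hx => by
    rw [hFdef, IccExtend_of_mem _ _ hx]; rfl
  have hF : ∀ J ≤ period, BoxIntegral.integral J BoxIntegral.IntegrationParams.Henstock
        (fun x : Fin 1 → ℝ => f (x 0)) lengthMap = F (J.upper 0) - F (J.lower 0) := by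
    intro J hJ
    obtain ⟨h1, h2⟩ := le_period_iff.1 hJ
    have h3 := J.lower_lt_upper 0
    rw [hF₀ J hJ, hFe _ ⟨h1.trans h3.le, h2⟩, hFe _ ⟨h1, h3.le.trans h2⟩]
  refine ⟨F, hFc, fun g g' hg hg' => ?_⟩
  have hgc : Continuous g := continuous_iff_continuousAt.2 fun x => (hg x).continuousAt
  have hFg : Continuous fun s => F s * g' s := hFc.mul hg'
  obtain ⟨M, hM⟩ := isCompact_Icc.exists_bound_of_continuousOn (s := Icc (-π) π) hgc.continuousOn
  obtain ⟨M', hM'⟩ := isCompact_Icc.exists_bound_of_continuousOn (s := Icc (-π) π)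
    hg'.continuousOn
  have M0 : 0 ≤ M := (norm_nonneg _).trans (hM π ⟨hpi, le_rfl⟩)
  have M0' : 0 ≤ M' := (norm_nonneg _).trans (hM' π ⟨hpi, le_rfl⟩)
  set H : ℝ → ℝ := fun x => F x * g x - ∫ s in -π..x, F s * g' s with hH
  have hval : F π * g π - F (-π) * g (-π) - ∫ x in -π..π, F x * g' x
      = increment H period period := by
    rw [increment_apply]
    simp only [period, hH, intervalIntegral.integral_same]
    ring
  rw [hval]
  -- M weights the Saks–Henstock error of f; 2M' · 2π is the local Stieltjes error summed over the
  -- total length 2π.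
  refine BoxIntegral.HasIntegral.of_mul (M + 2 * M' * (2 * π)) fun ε hε => ?_
  obtain ⟨r, hr⟩ := exists_gauge hf hF hε
  have huc := isCompact_Icc.uniformContinuousOn_of_continuous (s := Icc (-π) π) hFc.continuousOn
  obtain ⟨δ, hδ, hδF⟩ := Metric.uniformContinuousOn_iff.1 huc ε hε
  refine ⟨fun _ x => min (r x) ⟨δ / 2, half_pos hδ⟩,
    fun _ => BoxIntegral.IntegrationParams.rCond_of_bRiemann_eq_false _ rfl, fun _ P hP hPp => ?_⟩
  have hsub := hr P (hP.isSubordinate.mono fun x _ => min_le_left _ _) (hP.isHenstock rfl)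
  rw [← (increment H period).sum_partition_boxes le_rfl hPp, BoxIntegral.integralSum,
    Real.dist_eq, ← Finset.sum_sub_distrib]
  have hlen : ∑ J ∈ P.boxes, (J.upper 0 - J.lower 0) = 2 * π := by
    have := (increment id period).sum_partition_boxes le_rfl hPp
    simp only [increment_apply] at this
    exact this.trans (by simp only [period, id]; ring)
  calc |∑ J ∈ P.boxes, (lengthMap J (f (P.tag J 0) * g (P.tag J 0)) - increment H period J)|
      ≤ ∑ J ∈ P.boxes, |lengthMap J (f (P.tag J 0) * g (P.tag J 0)) - increment H period J| :=
        Finset.abs_sum_le_sum_abs _ _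
    _ ≤ ∑ J ∈ P.boxes, (M * |(J.upper 0 - J.lower 0) * f (P.tag J 0)
        - (F (J.upper 0) - F (J.lower 0))| + 2 * ε * M' * (J.upper 0 - J.lower 0)) := ?_
    _ ≤ (M + 2 * M' * (2 * π)) * ε := by
        rw [Finset.sum_add_distrib, ← Finset.mul_sum, ← Finset.mul_sum, hlen]
        nlinarith [mul_le_mul_of_nonneg_left hsub M0]
  refine Finset.sum_le_sum fun J hJ => ?_
  have hJ' : J ∈ P := hJ
  obtain ⟨h1, h2⟩ := le_period_iff.1 (P.le_of_mem' J hJ)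
  have htJ := mem_Icc_iff.1 (hP.isHenstock rfl J hJ')
  have htI : P.tag J 0 ∈ Icc (-π) π := ⟨h1.trans htJ.1, htJ.2.trans h2⟩
  have hball := hP.isSubordinate J hJ'
  have hs : ∀ s ∈ Icc (J.lower 0) (J.upper 0), |F s - F (P.tag J 0)| ≤ ε := by
    intro s hs
    have hm : (fun _ : Fin 1 => s) ∈ BoxIntegral.Box.Icc J := mem_Icc_iff.2 hs
    have := hball hm
    rw [mem_closedBall_iff_norm] at this
    have h4 : |s - P.tag J 0| ≤ _ := (norm_le_pi_norm ((fun _ : Fin 1 => s) - P.tag J) 0).trans this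
    have h5 : |s - P.tag J 0| ≤ δ / 2 := h4.trans (min_le_right (r (P.tag J)) ⟨δ / 2, half_pos hδ⟩)
    exact (hδF s ⟨h1.trans hs.1, hs.2.trans h2⟩ _ htI (by rw [Real.dist_eq]; linarith)).le
  have hloc := stieltjes_local_bound hFc hg hg' htJ.1 htJ.2
    (fun s hs => hM' s ⟨h1.trans hs.1, hs.2.trans h2⟩) hs
  have hHinc : increment H period J = (F (J.upper 0) * g (J.upper 0) - F (J.lower 0) * g (J.lower 0))
      - ∫ s in J.lower 0..J.upper 0, F s * g' s := by
    rw [increment_apply, ← intervalIntegral.integral_interval_sub_left (a := -π)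
      (hFg.intervalIntegrable _ _) (hFg.intervalIntegrable _ _)]
    simp only [hH]; ring
  rw [← hHinc] at hloc
  have e : lengthMap J (f (P.tag J 0) * g (P.tag J 0)) - increment H period J
      = g (P.tag J 0) * ((J.upper 0 - J.lower 0) * f (P.tag J 0)
        - (F (J.upper 0) - F (J.lower 0)))
        + (g (P.tag J 0) * (F (J.upper 0) - F (J.lower 0)) - increment H period J) := by
    rw [lengthMap_apply]; ring
  rw [e]
  refine (abs_add_le _ _).trans (add_le_add ?_ hloc)
  rw [abs_mul]
  exact mul_le_mul_of_nonneg_right (hM _ htI) (abs_nonneg _)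

/-- Integration by parts for a primitive in the sense of derivatives. -/
theorem hasHK_mul_of_hasDerivAt {F f : ℝ → ℝ} (hF : Continuous F) {s : Set ℝ} (hs : s.Countable)
    (hd : ∀ x ∉ s, HasDerivAt F (f x) x) {g g' : ℝ → ℝ} (hg : ∀ x, HasDerivAt g (g' x) x)
    (hg' : Continuous g') :
    HasHK (fun x => f x * g x) (F π * g π - F (-π) * g (-π) - ∫ x in -π..π, F x * g' x) := by
  have hgc : Continuous g := continuous_iff_continuousAt.2 fun x => (hg x).continuousAt
  have hFg : Continuous fun x => F x * g' x := hF.mul hg'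
  -- F g - ∫ F g' is a primitive of f g off the same countable set.
  have := hasHK_of_hasDerivAt (F := fun x => F x * g x - ∫ t in -π..x, F t * g' t)
    (f := fun x => f x * g x) ((hF.mul hgc).sub
      (intervalIntegral.continuous_primitive (fun a b => hFg.intervalIntegrable a b) _)) hs
    fun x hx => by
      have h1 := ((hd x hx).mul (hg x)).sub (hFg.integral_hasStrictDerivAt (-π) x).hasDerivAt
      exact h1.congr_deriv (by ring)
  convert this using 1
  simp only [intervalIntegral.integral_same]; ring

/-! ### The Poisson kernel -/

/-- The derivative of the Poisson kernel with respect to the angle. -/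
noncomputable def kernelDeriv (r t : ℝ) : ℝ :=
  -((1 - r ^ 2) * (2 * r * sin t)) / (2 * π * (1 - 2 * r * cos t + r ^ 2) ^ 2)

lemma kernel_den_ge {r : ℝ} (hr : 0 ≤ r) (t : ℝ) :
    (1 - r) ^ 2 ≤ 1 - 2 * r * cos t + r ^ 2 := by
  nlinarith [cos_le_one t]

lemma kernel_den_pos {r : ℝ} (hr : r ∈ Ico (0 : ℝ) 1) (t : ℝ) :
    0 < 1 - 2 * r * cos t + r ^ 2 :=
  lt_of_lt_of_le (pow_pos (sub_pos.2 hr.2) 2) (kernel_den_ge hr.1 t)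

lemma hasDerivAt_kernel {r : ℝ} (hr : r ∈ Ico (0 : ℝ) 1) (t : ℝ) :
    HasDerivAt (kernel r) (kernelDeriv r t) t := by
  have h0 := kernel_den_pos hr t
  have h1 : HasDerivAt (fun t => 2 * π * (1 - 2 * r * cos t + r ^ 2))
      (2 * π * (2 * r * sin t)) t := by
    have := ((((hasDerivAt_cos t).const_mul (2 * r)).const_sub 1).add_const (r ^ 2)).const_mul
      (2 * π)
    exact this.congr_deriv (by ring)
  have h2 := (hasDerivAt_const t (1 - r ^ 2)).div h1 (by positivity)
  refine h2.congr_deriv ?_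
  rw [kernelDeriv]
  field_simp
  ring

lemma continuous_kernel {r : ℝ} (hr : r ∈ Ico (0 : ℝ) 1) : Continuous (kernel r) :=
  continuous_iff_continuousAt.2 fun t => (hasDerivAt_kernel hr t).continuousAt

lemma continuous_kernelDeriv {r : ℝ} (hr : r ∈ Ico (0 : ℝ) 1) : Continuous (kernelDeriv r) := by
  unfold kernelDeriv
  refine Continuous.div (by fun_prop) (by fun_prop) fun t => ?_
  have := kernel_den_pos hr t
  positivity

lemma kernel_nonneg {r : ℝ} (hr : r ∈ Ico (0 : ℝ) 1) (t : ℝ) : 0 ≤ kernel r t := by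
  have := kernel_den_pos hr t
  refine div_nonneg ?_ (by positivity)
  nlinarith [hr.1, hr.2]

lemma kernel_le {r : ℝ} (hr : r ∈ Ico (0 : ℝ) 1) (t : ℝ) : kernel r t ≤ 1 / (1 - r) := by
  have h0 := kernel_den_pos hr t
  have h1 : 0 < 1 - r := sub_pos.2 hr.2
  rw [kernel, div_le_div_iff₀ (by positivity) h1]
  have h2 : 2 * (1 - 2 * r * cos t + r ^ 2) ≤ 2 * π * (1 - 2 * r * cos t + r ^ 2) := by
    nlinarith [pi_gt_three]
  nlinarith [kernel_den_ge hr.1 t, hr.1]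

lemma kernel_periodic (r : ℝ) : Function.Periodic (kernel r) (2 * π) := fun t => by
  simp [kernel]

lemma kernelDeriv_periodic (r : ℝ) : Function.Periodic (kernelDeriv r) (2 * π) := fun t => by
  simp [kernelDeriv]

/-- The kernel increases on [-π, 0] and decreases on [0, π], so its total variation over a period is
2(Φ_r(0) - Φ_r(π)). This is one of the two sources of the rate 1/(1-r). -/
lemma integral_abs_kernelDeriv_le {r : ℝ} (hr : r ∈ Ico (0 : ℝ) 1) (θ : ℝ) :
    ∫ φ in -π..π, |kernelDeriv r (φ - θ)| ≤ 2 / (1 - r) := by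
  have hc : Continuous fun t => |kernelDeriv r t| := (continuous_kernelDeriv hr).abs
  have hper : Function.Periodic (fun t => |kernelDeriv r t|) (2 * π) := fun t => by
    simp only [kernelDeriv_periodic r t]
  have e : ∫ φ in -π..π, |kernelDeriv r (φ - θ)| = ∫ t in -π..π, |kernelDeriv r t| := by
    rw [intervalIntegral.integral_comp_sub_right (fun t => |kernelDeriv r t|)]
    have := hper.intervalIntegral_add_eq (-π - θ) (-π)
    rw [show -π - θ + 2 * π = π - θ by ring, show -π + 2 * π = π by ring] at this
    exact this
  have hr2 : 0 ≤ 1 - r ^ 2 := by nlinarith [hr.1, hr.2]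
  have e1 : ∫ t in -π..0, |kernelDeriv r t| = kernel r 0 - kernel r (-π) := by
    rw [← intervalIntegral.integral_eq_sub_of_hasDerivAt (fun x _ => hasDerivAt_kernel hr x)
      ((continuous_kernelDeriv hr).intervalIntegrable _ _)]
    refine intervalIntegral.integral_congr fun t ht => ?_
    rw [uIcc_of_le (by linarith [pi_pos])] at ht
    have := sin_nonpos_of_nonpos_of_neg_pi_le ht.2 ht.1
    refine abs_of_nonneg (div_nonneg ?_ (by positivity))
    have := mul_nonneg hr2 (mul_nonneg hr.1 (neg_nonneg.2 this))
    linarith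
  have e2 : ∫ t in (0 : ℝ)..π, |kernelDeriv r t| = kernel r 0 - kernel r π := by
    rw [← neg_sub, ← intervalIntegral.integral_eq_sub_of_hasDerivAt
      (fun x _ => hasDerivAt_kernel hr x) ((continuous_kernelDeriv hr).intervalIntegrable _ _),
      ← intervalIntegral.integral_neg]
    refine intervalIntegral.integral_congr fun t ht => ?_
    rw [uIcc_of_le pi_pos.le] at ht
    have := sin_nonneg_of_nonneg_of_le_pi ht.1 ht.2
    refine abs_of_nonpos (div_nonpos_of_nonpos_of_nonneg ?_ (by positivity))
    have := mul_nonneg hr2 (mul_nonneg hr.1 this)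
    linarith
  rw [e, ← intervalIntegral.integral_add_adjacent_intervals (b := 0) (hc.intervalIntegrable _ _)
    (hc.intervalIntegrable _ _), e1, e2]
  have h1 := kernel_le hr 0
  have h2 := kernel_nonneg hr (-π)
  have h3 := kernel_nonneg hr π
  rw [show 2 / (1 - r) = 1 / (1 - r) + 1 / (1 - r) by ring]
  linarith

open Complex in
/-- The Poisson kernel reproduces the boundary values of `z ↦ z ^ n`. -/
lemma integral_kernel_smul_exp {r : ℝ} (hr : r ∈ Ico (0 : ℝ) 1) (θ : ℝ) (n : ℕ) :
    ∫ φ in -π..π, (kernel r (φ - θ)) • exp (n * φ * I) = r ^ n * exp (n * θ * I) := by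
  have hR : (0 : ℝ) < 1 := one_pos
  have hd : DiffContOnCl ℂ (fun z : ℂ => z ^ n) (Metric.ball 0 1) :=
    (differentiable_pow n).diffContOnCl
  have hw : (r * exp (θ * I) : ℂ) ∈ Metric.ball (0 : ℂ) 1 := by
    rw [mem_ball_zero_iff, norm_mul, norm_exp_ofReal_mul_I, norm_real, mul_one,
      Real.norm_of_nonneg hr.1]
    exact hr.2
  -- The Poisson formula for the holomorphic function z ^ n at the point r e^{iθ}; what remains is
  -- to identify the two forms of the kernel.
  have key := hd.circleAverage_poissonKernel_smul hw
  rw [Real.circleAverage_def] at key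
  have hper : Function.Periodic (fun φ : ℝ => (kernel r (φ - θ)) • exp (n * φ * I)) (2 * π) := by
    intro φ
    have h1 : kernel r (φ + 2 * π - θ) = kernel r (φ - θ) := by
      rw [← kernel_periodic r (φ - θ)]; ring_nf
    have h2 : exp (n * ((φ + 2 * π : ℝ) : ℂ) * I) = exp (n * φ * I) := by
      rw [← exp_periodic.nat_mul n (n * φ * I)]
      congr 1; push_cast; ring
    simp only [h1, h2]
  have e := hper.intervalIntegral_add_eq (-π) 0
  rw [show -π + 2 * π = π by ring, zero_add] at e
  rw [e]
  have e2 : (r * exp (θ * I) : ℂ) ^ n = r ^ n * exp (n * θ * I) := by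
    rw [mul_pow, ← Complex.exp_nat_mul]; congr 2; ring
  rw [← e2, ← key, ← intervalIntegral.integral_smul]
  refine intervalIntegral.integral_congr fun φ _ => ?_
  have e3 : (circleMap 0 1 φ) ^ n = exp (n * φ * I) := by
    simp only [circleMap, ofReal_one, one_mul, zero_add]
    rw [← Complex.exp_nat_mul]; congr 1; ring
  have e4 : (2 * π)⁻¹ * poissonKernel 0 (r * exp (θ * I)) (circleMap 0 1 φ) = kernel r (φ - θ) := by
    have h5 : ‖circleMap 0 1 φ‖ = 1 := by simp
    have h6 : ‖circleMap 0 1 φ - r * exp (θ * I)‖ ^ 2 = 1 - 2 * r * Real.cos (φ - θ) + r ^ 2 := by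
      rw [← normSq_eq_norm_sq, normSq_apply]
      simp only [circleMap, ofReal_one, one_mul, zero_add, sub_re, sub_im, exp_ofReal_mul_I_re,
        exp_ofReal_mul_I_im, re_ofReal_mul, im_ofReal_mul]
      rw [Real.cos_sub]
      linear_combination (Real.sin_sq_add_cos_sq φ) + r ^ 2 * (Real.sin_sq_add_cos_sq θ)
    rw [poissonKernel_def, sub_zero, sub_zero, h5, h6, norm_mul, norm_exp_ofReal_mul_I, norm_real,
      mul_one, Real.norm_of_nonneg hr.1, kernel]
    have := kernel_den_pos hr (φ - θ)
    field_simp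
  simp only [Pi.smul_apply', e3]
  rw [smul_smul, e4]

lemma integral_kernel {r : ℝ} (hr : r ∈ Ico (0 : ℝ) 1) (θ : ℝ) :
    ∫ φ in -π..π, kernel r (φ - θ) = 1 := by
  have h := integral_kernel_smul_exp hr θ 0
  simp only [CharP.cast_eq_zero, zero_mul, Complex.exp_zero, pow_zero, mul_one,
    Complex.real_smul] at h
  rw [intervalIntegral.integral_ofReal] at h
  exact_mod_cast h

lemma integral_kernel_mul_sin {r : ℝ} (hr : r ∈ Ico (0 : ℝ) 1) (θ : ℝ) (n : ℕ) :
    ∫ φ in -π..π, kernel r (φ - θ) * sin (n * φ) = r ^ n * sin (n * θ) := by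
  have h := congrArg Complex.imCLM (integral_kernel_smul_exp hr θ n)
  have hc := continuous_kernel hr
  rw [← ContinuousLinearMap.intervalIntegral_comp_comm _
    (Continuous.intervalIntegrable (by fun_prop) _ _)] at h
  have e : ∀ x : ℝ, (Complex.exp (n * x * Complex.I)).im = sin (n * x) := fun x => by
    have := Complex.exp_ofReal_mul_I_im (n * x)
    push_cast at this; exact this
  have e2 : ((r : ℂ) ^ n * Complex.exp (n * θ * Complex.I)).im = r ^ n * sin (n * θ) := by
    rw [← Complex.ofReal_pow, Complex.im_ofReal_mul, e]
  simpa [Complex.imCLM_apply, e, e2] using h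

/-! ### The upper estimates -/

/-- The Poisson integral of the derivative of `F`, after integration by parts. -/
noncomputable def poissonDeriv (F : ℝ → ℝ) (r θ : ℝ) : ℝ :=
  (F π - F (-π)) * kernel r (π - θ) - ∫ φ in -π..π, F φ * kernelDeriv r (φ - θ)

lemma hasDerivAt_kernel_sub {r : ℝ} (hr : r ∈ Ico (0 : ℝ) 1) (θ φ : ℝ) :
    HasDerivAt (fun φ => kernel r (φ - θ)) (kernelDeriv r (φ - θ)) φ :=
  (hasDerivAt_kernel hr (φ - θ)).comp_sub_const φ θ

lemma continuous_kernelDeriv_sub {r : ℝ} (hr : r ∈ Ico (0 : ℝ) 1) (θ : ℝ) :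
    Continuous fun φ => kernelDeriv r (φ - θ) :=
  (continuous_kernelDeriv hr).comp (continuous_sub_right θ)

lemma poissonDeriv_eq (F : ℝ → ℝ) (r θ : ℝ) :
    poissonDeriv F r θ = F π * kernel r (π - θ) - F (-π) * kernel r (-π - θ)
      - ∫ φ in -π..π, F φ * kernelDeriv r (φ - θ) := by
  have : kernel r (π - θ) = kernel r (-π - θ) := by
    rw [← kernel_periodic r (-π - θ)]; ring_nf
  rw [poissonDeriv, this]; ring

theorem exists_hasHK_poisson {f : ℝ → ℝ} (hf : HKIntegrable f) :
    ∃ F : ℝ → ℝ, Continuous F ∧ ∀ r ∈ Ico (0 : ℝ) 1, ∀ θ : ℝ,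
      HasHK (fun φ => f φ * kernel r (φ - θ)) (poissonDeriv F r θ) := by
  obtain ⟨F, hF, H⟩ := exists_hasHK_mul hf
  refine ⟨F, hF, fun r hr θ => ?_⟩
  rw [poissonDeriv_eq]
  exact H _ _ (hasDerivAt_kernel_sub hr θ) (continuous_kernelDeriv_sub hr θ)

lemma continuous_poissonDeriv {F : ℝ → ℝ} (hF : Continuous F) {r : ℝ} (hr : r ∈ Ico (0 : ℝ) 1) :
    Continuous (poissonDeriv F r) := by
  have h1 := continuous_kernel hr
  have h2 := continuous_kernelDeriv hr
  refine Continuous.sub (by fun_prop) ?_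
  exact intervalIntegral.continuous_parametric_intervalIntegral_of_continuous'
    (f := fun θ φ => F φ * kernelDeriv r (φ - θ)) (by fun_prop) _ _

/-- Of the factor 4, one 2 comes from F(π) - F(-π) in the boundary term and the other from the total
variation of the kernel. -/
lemma abs_poissonDeriv_le {F : ℝ → ℝ} (hF : Continuous F) {ε : ℝ}
    (hε : ∀ x ∈ Icc (-π) π, |F x| ≤ ε) {r : ℝ} (hr : r ∈ Ico (0 : ℝ) 1) (θ : ℝ) :
    |poissonDeriv F r θ| ≤ 4 * ε / (1 - r) := by
  have hpi : -π ≤ π := by linarith [pi_pos]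
  have ε0 : 0 ≤ ε := (abs_nonneg _).trans (hε π ⟨hpi, le_rfl⟩)
  have h1 : |(F π - F (-π)) * kernel r (π - θ)| ≤ (2 * ε) * (1 / (1 - r)) := by
    rw [abs_mul, abs_of_nonneg (kernel_nonneg hr _)]
    refine mul_le_mul ?_ (kernel_le hr _) (kernel_nonneg hr _) (by positivity)
    have := abs_sub (F π) (F (-π))
    linarith [hε π ⟨hpi, le_rfl⟩, hε (-π) ⟨le_rfl, hpi⟩]
  have hk := continuous_kernelDeriv_sub hr θ
  have h2 : |∫ φ in -π..π, F φ * kernelDeriv r (φ - θ)| ≤ ε * (2 / (1 - r)) := by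
    refine (intervalIntegral.abs_integral_le_integral_abs hpi).trans ?_
    refine le_trans ?_ (mul_le_mul_of_nonneg_left (integral_abs_kernelDeriv_le hr θ) ε0)
    rw [← intervalIntegral.integral_const_mul]
    refine intervalIntegral.integral_mono_on hpi
      ((hF.mul hk).abs.intervalIntegrable _ _)
      ((hk.abs.const_mul ε).intervalIntegrable _ _) fun x hx => ?_
    rw [abs_mul]
    exact mul_le_mul_of_nonneg_right (hε x hx) (abs_nonneg _)
  refine (abs_sub _ _).trans ((add_le_add h1 h2).trans_eq ?_)
  ring

lemma poissonDeriv_sub {F G : ℝ → ℝ} (hF : Continuous F) (hG : Continuous G) {r : ℝ}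
    (hr : r ∈ Ico (0 : ℝ) 1) (θ : ℝ) :
    poissonDeriv (fun x => F x - G x) r θ = poissonDeriv F r θ - poissonDeriv G r θ := by
  have hk := continuous_kernelDeriv_sub hr θ
  have hFk : Continuous fun φ => F φ * kernelDeriv r (φ - θ) := hF.mul hk
  have hGk : Continuous fun φ => G φ * kernelDeriv r (φ - θ) := hG.mul hk
  simp only [poissonDeriv, sub_mul]
  rw [intervalIntegral.integral_sub (hFk.intervalIntegrable _ _) (hGk.intervalIntegrable _ _)]
  ring

/-- Integrating by parts back gives the Poisson integral of G', an average because the kernel is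
nonnegative with integral 1. The bound does not depend on r. -/
lemma abs_poissonDeriv_le_of_hasDerivAt {G G' : ℝ → ℝ} (hG : ∀ x, HasDerivAt G (G' x) x)
    (hG' : Continuous G') {M : ℝ} (hM : ∀ x ∈ Icc (-π) π, |G' x| ≤ M) {r : ℝ}
    (hr : r ∈ Ico (0 : ℝ) 1) (θ : ℝ) : |poissonDeriv G r θ| ≤ M := by
  have hpi : -π ≤ π := by linarith [pi_pos]
  have hk := continuous_kernelDeriv_sub hr θ
  have hk' : Continuous fun φ => kernel r (φ - θ) :=
    (continuous_kernel hr).comp (continuous_sub_right θ)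
  rw [poissonDeriv_eq, intervalIntegral.integral_mul_deriv_eq_deriv_mul
    (fun x _ => hG x) (fun x _ => hasDerivAt_kernel_sub hr θ x)
    (hG'.intervalIntegrable _ _) (hk.intervalIntegrable _ _), sub_sub_cancel]
  refine (intervalIntegral.abs_integral_le_integral_abs hpi).trans ?_
  calc ∫ x in -π..π, |G' x * kernel r (x - θ)|
      ≤ ∫ x in -π..π, M * kernel r (x - θ) := by
        refine intervalIntegral.integral_mono_on hpi
          ((hG'.mul hk').abs.intervalIntegrable _ _)
          ((hk'.const_mul M).intervalIntegrable _ _) fun x hx => ?_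
        rw [abs_mul, abs_of_nonneg (kernel_nonneg hr _)]
        exact mul_le_mul_of_nonneg_right (hM x hx) (kernel_nonneg hr _)
    _ = M := by rw [intervalIntegral.integral_const_mul, integral_kernel hr, mul_one]

/-- The Poisson integral of the derivative of a continuous function is uniformly
`o(1 / (1 - r))`. -/
lemma eventually_abs_poissonDeriv_le {F : ℝ → ℝ} (hF : Continuous F) {ε : ℝ} (hε : 0 < ε) :
    ∀ᶠ r in 𝓝[<] (1 : ℝ), r ∈ Ico (0 : ℝ) 1 ∧ ∀ θ, |poissonDeriv F r θ| ≤ ε * (1 / (1 - r)) := by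
  -- The error ε/8 costs 4 · ε/8 = ε/2 in units of 1/(1-r); the polynomial contributes a bounded M,
  -- which is below the other half once r is near 1.
  obtain ⟨p, hp⟩ := exists_polynomial_near_of_continuousOn (-π) π F hF.continuousOn (ε / 8)
    (by positivity)
  obtain ⟨M, hM⟩ := isCompact_Icc.exists_bound_of_continuousOn (s := Icc (-π) π)
    p.derivative.continuous.continuousOn
  have h0 : ∀ᶠ r in 𝓝[<] (1 : ℝ), r ∈ Ico (0 : ℝ) 1 := by
    filter_upwards [Ioo_mem_nhdsLT (show (0 : ℝ) < 1 by norm_num)] with r hr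
    exact ⟨hr.1.le, hr.2⟩
  have h1 : ∀ᶠ r in 𝓝[<] (1 : ℝ), M * (1 - r) < ε / 2 := by
    have : Tendsto (fun r : ℝ => M * (1 - r)) (𝓝[<] 1) (𝓝 0) := by
      have : Continuous fun r : ℝ => M * (1 - r) := by fun_prop
      simpa using (this.tendsto 1).mono_left nhdsWithin_le_nhds
    exact this.eventually_lt_const (by positivity)
  filter_upwards [h0, h1] with r hr hMr
  refine ⟨hr, fun θ => ?_⟩
  have hpos : 0 < 1 - r := sub_pos.2 hr.2
  have e1 := abs_poissonDeriv_le (F := fun x => F x - p.eval x) (hF.sub p.continuous)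
    (fun x hx => by rw [abs_sub_comm]; exact (hp x hx).le) hr θ
  have e2 := abs_poissonDeriv_le_of_hasDerivAt (fun x => p.hasDerivAt x) p.derivative.continuous
    hM hr θ
  rw [poissonDeriv_sub hF p.continuous hr] at e1
  have e3 : M ≤ ε / 2 / (1 - r) := by rw [le_div_iff₀ hpos]; exact hMr.le
  have e4 := abs_sub_abs_le_abs_sub (poissonDeriv F r θ) (poissonDeriv (fun x => p.eval x) r θ)
  have e5 : ε * (1 / (1 - r)) = 4 * (ε / 8) / (1 - r) + ε / 2 / (1 - r) := by ring
  linarith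

lemma continuous_poisson {f : ℝ → ℝ} (hf : HKIntegrable f) {r : ℝ} (hr : r ∈ Ico (0 : ℝ) 1) :
    Continuous (poisson f r) := by
  obtain ⟨F, hF, H⟩ := exists_hasHK_poisson hf
  have : poisson f r = poissonDeriv F r := funext fun θ => (H r hr θ).integral_eq
  rw [this]
  exact continuous_poissonDeriv hF hr

lemma exists_abs_poisson_le {f : ℝ → ℝ} (hf : HKIntegrable f) {r : ℝ} (hr : r ∈ Ico (0 : ℝ) 1) :
    ∃ C, ∀ θ, |poisson f r θ| ≤ C := by
  obtain ⟨F, hF, H⟩ := exists_hasHK_poisson hf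
  obtain ⟨M, hM⟩ := isCompact_Icc.exists_bound_of_continuousOn (s := Icc (-π) π) hF.continuousOn
  refine ⟨4 * M / (1 - r), fun θ => ?_⟩
  rw [show poisson f r θ = _ from (H r hr θ).integral_eq]
  exact abs_poissonDeriv_le hF hM hr θ

lemma eventually_abs_poisson_le {f : ℝ → ℝ} (hf : HKIntegrable f) {ε : ℝ} (hε : 0 < ε) :
    ∀ᶠ r in 𝓝[<] (1 : ℝ), r ∈ Ico (0 : ℝ) 1 ∧ ∀ θ, |poisson f r θ| ≤ ε * (1 / (1 - r)) := by
  obtain ⟨F, hF, H⟩ := exists_hasHK_poisson hf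
  filter_upwards [eventually_abs_poissonDeriv_le hF hε] with r hr
  refine ⟨hr.1, fun θ => ?_⟩
  rw [show poisson f r θ = _ from (H r hr.1 θ).integral_eq]
  exact hr.2 θ

theorem iSup_abs_poisson_isLittleO {f : ℝ → ℝ} (hf : HKIntegrable f) :
    (fun r : ℝ => ⨆ θ : Icc (-π) π, |poisson f r θ|) =o[𝓝[<] 1] fun r : ℝ => 1 / (1 - r) := by
  have : Nonempty (Icc (-π) π) := ⟨⟨π, by linarith [pi_pos], le_rfl⟩⟩
  refine Asymptotics.isLittleO_iff.2 fun ε hε => ?_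
  filter_upwards [eventually_abs_poisson_le hf hε] with r hr
  rw [Real.norm_of_nonneg (Real.iSup_nonneg fun _ => abs_nonneg _),
    Real.norm_of_nonneg (one_div_nonneg.2 (sub_nonneg.2 hr.1.2.le))]
  exact ciSup_le fun θ => hr.2 θ

instance : IsFiniteMeasure circleMeasure :=
  ⟨by simp [circleMeasure]⟩

theorem memLp_poisson {f : ℝ → ℝ} (hf : HKIntegrable f) (p : ENNReal) {r : ℝ}
    (hr : r ∈ Ico (0 : ℝ) 1) : MemLp (poisson f r) p circleMeasure := by
  obtain ⟨C, hC⟩ := exists_abs_poisson_le hf hr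
  exact MemLp.of_bound (continuous_poisson hf hr).aestronglyMeasurable C (.of_forall hC)

theorem eLpNorm_poisson_isLittleO {f : ℝ → ℝ} (hf : HKIntegrable f) (p : ENNReal) :
    (fun r : ℝ => (eLpNorm (poisson f r) p circleMeasure).toReal)
      =o[𝓝[<] 1] fun r : ℝ => 1 / (1 - r) := by
  set K : ENNReal := circleMeasure univ ^ p.toReal⁻¹ with hK
  have hKtop : K ≠ ⊤ := ENNReal.rpow_ne_top_of_nonneg (by positivity) (measure_ne_top _ _)
  refine Asymptotics.isLittleO_iff.2 fun ε hε => ?_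
  -- K is the factor by which a uniform bound becomes an Lᵖ bound; the added 1 makes the denominator
  -- visibly positive.
  filter_upwards [eventually_abs_poisson_le hf (ε := ε / (K.toReal + 1)) (by positivity)] with r hr
  have hr0 : 0 ≤ 1 / (1 - r) := one_div_nonneg.2 (sub_nonneg.2 hr.1.2.le)
  have h1 := eLpNorm_le_of_ae_bound (f := poisson f r) (p := p) (μ := circleMeasure) (.of_forall hr.2)
  have h2 := ENNReal.toReal_mono (ENNReal.mul_ne_top hKtop ENNReal.ofReal_ne_top) h1
  rw [ENNReal.toReal_mul, ENNReal.toReal_ofReal (by positivity)] at h2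
  rw [Real.norm_of_nonneg ENNReal.toReal_nonneg, Real.norm_of_nonneg hr0]
  refine h2.trans ?_
  rw [← mul_assoc]
  refine mul_le_mul_of_nonneg_right ?_ hr0
  rw [mul_div_assoc', div_le_iff₀ (by positivity)]
  nlinarith [hε, ENNReal.toReal_nonneg (a := K)]

/-! ### Sharpness of the uniform estimate -/

/-- The `2π`-periodic function that agrees with `g` on `(-π, π]`. -/
noncomputable def periodize (g : ℝ → ℝ) (x : ℝ) : ℝ := g (toIocMod two_pi_pos (-π) x)

lemma periodize_periodic (g : ℝ → ℝ) : Function.Periodic (periodize g) (2 * π) := fun x => by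
  simp only [periodize, toIocMod_add_right]

lemma periodize_eq (g : ℝ → ℝ) {x : ℝ} (hx : x ∈ Ioc (-π) π) : periodize g x = g x := by
  rw [periodize, (toIocMod_eq_self two_pi_pos).2]
  rwa [show -π + 2 * π = π by ring]

/-- Lebesgue integrable functions are Henstock–Kurzweil integrable, with the same integral. -/
theorem hasHK_of_integrableOn {g : ℝ → ℝ} (hg : IntegrableOn g (Ioc (-π) π)) :
    HasHK g (∫ x in Ioc (-π) π, g x) := by
  have hmp := volume_preserving_funUnique (Fin 1) ℝ
  have hemb := (MeasurableEquiv.funUnique (Fin 1) ℝ).measurableEmbedding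
  have hpre : (MeasurableEquiv.funUnique (Fin 1) ℝ) ⁻¹' (Ioc (-π) π) = (period : Set (Fin 1 → ℝ)) := by
    ext x
    rw [BoxIntegral.Box.mem_coe, BoxIntegral.Box.mem_def]
    simp [period, MeasurableEquiv.funUnique]
  have h1 := (hmp.integrableOn_comp_preimage hemb).2 hg
  have h2 := hmp.setIntegral_preimage_emb hemb g (Ioc (-π) π)
  rw [hpre] at h1 h2
  rw [← h2]
  exact IntegrableOn.hasBoxIntegral h1 BoxIntegral.IntegrationParams.Henstock rfl

/-- The denominator is (1-r)² + 2r(1 - cos t) ≤ (1-r)² + r t², at most 2(1-r)² in this window. Thus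
the kernel is comparable to its peak on an interval of length comparable to 1-r. -/
lemma kernel_lower_bound {r : ℝ} (hr : r ∈ Ico (0 : ℝ) 1) {t : ℝ} (ht : |t| ≤ 1 - r) :
    1 / (4 * π * (1 - r)) ≤ kernel r t := by
  have h0 := kernel_den_pos hr t
  have h1 : 0 < 1 - r := sub_pos.2 hr.2
  have h2 : 1 - 2 * r * cos t + r ^ 2 ≤ 2 * (1 - r) ^ 2 := by
    have := one_sub_sq_div_two_le_cos (x := t)
    have h3 : t ^ 2 ≤ (1 - r) ^ 2 := sq_le_sq' (by linarith [neg_abs_le t]) ((le_abs_self t).trans ht)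
    nlinarith [hr.1, hr.2, sq_nonneg t]
  rw [kernel, div_le_div_iff₀ (by positivity) (by positivity)]
  have h3 : (1 - r) * (1 - r) ≤ (1 - r ^ 2) * (1 - r) := by nlinarith [hr.1]
  nlinarith [pi_pos, mul_le_mul_of_nonneg_left h2 pi_pos.le, mul_le_mul_of_nonneg_left h3 pi_pos.le]

/-- A superposition of bumps of mass `2⁻ᵏ` on the intervals `(0, w k]`. -/
noncomputable def bumps (w : ℕ → ℝ) (x : ℝ) : ENNReal :=
  ∑' k, (Ioc 0 (w k)).indicator (fun _ => ENNReal.ofReal ((1 / 2) ^ k / w k)) x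

lemma measurable_bumps (w : ℕ → ℝ) : Measurable (bumps w) :=
  Measurable.tsum fun _ => measurable_const.indicator measurableSet_Ioc

lemma lintegral_bumps {w : ℕ → ℝ} (hw : ∀ k, 0 < w k) : ∫⁻ x, bumps w x = 2 := by
  simp only [bumps]
  rw [lintegral_tsum fun k => (measurable_const.indicator measurableSet_Ioc).aemeasurable]
  have : ∀ k, ∫⁻ x, (Ioc 0 (w k)).indicator (fun _ => ENNReal.ofReal ((1 / 2) ^ k / w k)) x
      = ENNReal.ofReal ((1 / 2) ^ k) := by
    intro k
    rw [lintegral_indicator_const measurableSet_Ioc, Real.volume_Ioc, sub_zero,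
      ← ENNReal.ofReal_mul (by have := hw k; positivity), div_mul_cancel₀ _ (hw k).ne']
  simp_rw [this]
  rw [← ENNReal.ofReal_tsum_of_nonneg (fun k => by positivity) summable_geometric_two,
    tsum_geometric_two]
  simp

lemma integrable_bumps {w : ℕ → ℝ} (hw : ∀ k, 0 < w k) :
    Integrable fun x => (bumps w x).toReal :=
  integrable_toReal_of_lintegral_ne_top (measurable_bumps w).aemeasurable
    (by rw [lintegral_bumps hw]; simp)

/-- Only almost everywhere, because `toReal` sends an infinite value of the sum to 0. -/
lemma ae_le_bumps {w : ℕ → ℝ} (hw : ∀ k, 0 < w k) (k : ℕ) :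
    ∀ᵐ x, (Ioc 0 (w k)).indicator (fun _ => (1 / 2) ^ k / w k) x ≤ (bumps w x).toReal := by
  filter_upwards [ae_lt_top (measurable_bumps w) (by rw [lintegral_bumps hw]; simp)] with x hx
  have h1 := ENNReal.le_tsum (f := fun k => (Ioc 0 (w k)).indicator
    (fun _ => ENNReal.ofReal ((1 / 2) ^ k / w k)) x) k
  by_cases hxk : x ∈ Ioc 0 (w k)
  · simp only [indicator_of_mem hxk] at h1 ⊢
    have := ENNReal.toReal_mono hx.ne h1
    rwa [ENNReal.toReal_ofReal (by have := hw k; positivity)] at this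
  · rw [indicator_of_notMem hxk]; exact ENNReal.toReal_nonneg

lemma integrableOn_periodize_bumps {w : ℕ → ℝ} (hw : ∀ k, 0 < w k) :
    IntegrableOn (periodize fun x => (bumps w x).toReal) (Ioc (-π) π) :=
  ((integrable_bumps hw).integrableOn).congr_fun
    (fun _ hx => (periodize_eq (fun x => (bumps w x).toReal) hx).symm) measurableSet_Ioc

/-- With 1 - r = w k, the k-th bump lies where the kernel is at least 1/(4π w k), and its mass is
2⁻ᵏ. All other contributions are nonnegative. -/
lemma le_poisson_periodize_bumps {w : ℕ → ℝ} (hw : ∀ k, 0 < w k) (hw1 : ∀ k, w k ≤ 1) (k : ℕ) :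
    (1 / 2) ^ k / (4 * π * w k) ≤
      poisson (periodize fun x => (bumps w x).toReal) (1 - w k) 0 := by
  have hr : 1 - w k ∈ Ico (0 : ℝ) 1 := ⟨by linarith [hw1 k], by linarith [hw k]⟩
  have hk : Continuous fun φ => kernel (1 - w k) (φ - 0) :=
    (continuous_kernel hr).comp (continuous_sub_right 0)
  have hwpi : w k ≤ π := by linarith [hw1 k, pi_gt_three]
  have hi : ∀ g : ℝ → ℝ, IntegrableOn g (Ioc (-π) π) →
      IntegrableOn (fun φ => g φ * kernel (1 - w k) (φ - 0)) (Ioc (-π) π) := fun g hg =>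
    Integrable.mul_bdd (c := 1 / (1 - (1 - w k))) hg hk.aestronglyMeasurable (.of_forall fun x => by
      rw [Real.norm_of_nonneg (kernel_nonneg hr _)]; exact kernel_le hr _)
  rw [show poisson (periodize fun x => (bumps w x).toReal) (1 - w k) 0 = _ from
    (hasHK_of_integrableOn (hi _ (integrableOn_periodize_bumps hw))).integral_eq]
  have h1 : ∫ φ in Ioc (-π) π, (Ioc 0 (w k)).indicator (fun _ => (1 / 2) ^ k / w k * (1 / (4 * π * w k))) φ
      = (1 / 2) ^ k / (4 * π * w k) := by
    rw [setIntegral_indicator measurableSet_Ioc, Ioc_inter_Ioc, setIntegral_const]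
    rw [max_eq_right (by linarith [pi_pos]), min_eq_right hwpi]
    rw [Real.volume_real_Ioc_of_le (hw k).le, sub_zero, smul_eq_mul]
    have := (hw k).ne'
    field_simp
  rw [← h1]
  refine setIntegral_mono_on_ae ?_ (hi _ (integrableOn_periodize_bumps hw)) measurableSet_Ioc ?_
  · exact ((integrable_const _).indicator measurableSet_Ioc)
  · filter_upwards [ae_le_bumps hw k] with x hx hxI
    rw [periodize_eq _ hxI]
    by_cases hxk : x ∈ Ioc 0 (w k)
    · rw [indicator_of_mem hxk] at hx ⊢
      have := kernel_lower_bound hr (t := x - 0)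
        (by rw [sub_zero, abs_of_pos hxk.1]; linarith [hxk.2])
      rw [sub_sub_cancel] at this
      have hwk := hw k
      exact mul_le_mul hx this (by positivity) ENNReal.toReal_nonneg
    · rw [indicator_of_notMem hxk]
      exact mul_nonneg ENNReal.toReal_nonneg (kernel_nonneg hr _)

theorem exists_integrable_not_isLittleO (ψ : ℂ → ℝ) (hψ : ∀ z ∈ Metric.ball (0 : ℂ) 1, 0 < ψ z)
    (ho : (fun q : ℝ × ℝ => ψ (q.1 * Complex.exp (q.2 * Complex.I)))
        =o[𝓝[<] 1 ×ˢ ⊤] (fun q : ℝ × ℝ => 1 / (1 - q.1))) :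
    ∃ f ∈ HK, Integrable f circleMeasure ∧
        ¬ (fun q : ℝ × ℝ => poisson f q.1 q.2)
          =o[𝓝[<] 1 ×ˢ ⊤] fun q : ℝ × ℝ => ψ (q.1 * Complex.exp (q.2 * Complex.I)) := by
  have ht : Tendsto (fun r : ℝ => (r, (0 : ℝ))) (𝓝[<] 1) (𝓝[<] 1 ×ˢ ⊤) :=
    tendsto_id.prodMk tendsto_top
  have ho' := ho.comp_tendsto ht
  -- It is enough to test the ray θ = 0. There ψ(r)(1-r) → 0, so it falls below 2⁻ᵏ; the bound w <
  -- 2⁻ᵏ sends the radii to 1.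
  have hex : ∀ k : ℕ, ∃ w : ℝ, 0 < w ∧ w ≤ 1 ∧ w < (1 / 2) ^ k ∧
      ψ (((1 - w : ℝ) : ℂ) * Complex.exp (((0 : ℝ) : ℂ) * Complex.I)) ≤ (1 / 2) ^ k / w := by
    intro k
    have h2 : (1 : ℝ) - (1 / 2) ^ k < 1 := by
      have : (0 : ℝ) < (1 / 2) ^ k := by positivity
      linarith
    obtain ⟨r, h3, h4, h5⟩ := ((ho'.def (c := (1 / 2) ^ k) (by positivity)).and
      (inter_mem (Ioo_mem_nhdsLT (show (0 : ℝ) < 1 by norm_num)) (Ioo_mem_nhdsLT h2))).exists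
    refine ⟨1 - r, by linarith [h4.2], by linarith [h4.1], by linarith [h5.1], ?_⟩
    rw [sub_sub_cancel]
    refine (le_abs_self _).trans (h3.trans_eq ?_)
    have : 0 < 1 - r := by linarith [h4.2]
    simp only [Function.comp_apply]
    rw [Real.norm_of_nonneg (by positivity)]
    ring
  choose w hw hw1 hw2 hψw using hex
  refine ⟨periodize fun x => (bumps w x).toReal, ⟨periodize_periodic _,
    (hasHK_of_integrableOn (integrableOn_periodize_bumps hw)).integrable⟩,
    integrableOn_periodize_bumps hw, fun hcon => ?_⟩
  have hw0 : Tendsto w atTop (𝓝 0) :=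
    squeeze_zero (fun k => (hw k).le) (fun k => (hw2 k).le)
      (tendsto_pow_atTop_nhds_zero_of_lt_one (by norm_num) (by norm_num))
  have hseq : Tendsto (fun k => 1 - w k) atTop (𝓝[<] 1) := by
    refine tendsto_nhdsWithin_iff.2 ⟨?_, .of_forall fun k => ?_⟩
    · simpa using hw0.const_sub 1
    · simpa using hw k
  -- Along the chosen radii P[f] ≥ ψ/(4π), so half this constant gives a contradiction.
  obtain ⟨k, hk⟩ := (((hcon.comp_tendsto (ht.comp hseq)).def
    (c := 1 / (8 * π)) (by positivity))).exists
  simp only [Function.comp_apply] at hk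
  have h1 := le_poisson_periodize_bumps hw hw1 k
  have hpos : 0 < ψ (((1 - w k : ℝ) : ℂ) * Complex.exp (((0 : ℝ) : ℂ) * Complex.I)) := by
    refine hψ _ ?_
    rw [mem_ball_zero_iff, norm_mul, Complex.norm_exp_ofReal_mul_I, Complex.norm_real, mul_one,
      Real.norm_of_nonneg (by linarith [hw1 k])]
    linarith [hw k]
  rw [Real.norm_eq_abs, Real.norm_of_nonneg hpos.le] at hk
  have h2 := (h1.trans (le_abs_self _)).trans hk
  have h3 := hψw k
  have e : (1 / 2 : ℝ) ^ k / (4 * π * w k) = 1 / (4 * π) * ((1 / 2) ^ k / w k) := by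
    have := (hw k).ne'
    field_simp
  rw [e] at h2
  have h4 := h2.trans (mul_le_mul_of_nonneg_left h3 (by positivity))
  have h5 : 0 < (1 / 2 : ℝ) ^ k / w k := div_pos (by positivity) (hw k)
  rw [mul_le_mul_iff_left₀ h5, div_le_div_iff₀ (by positivity) (by positivity)] at h4
  linarith [pi_pos]

/-! ### Fourier coefficients of the Poisson integral -/

lemma HasHK.congr {f g : ℝ → ℝ} {y : ℝ} (h : HasHK f y) (hfg : EqOn f g (Icc (-π) π)) :
    HasHK g y :=
  (BoxIntegral.hasIntegral_congr _ _ (fun _ hx => hfg (mem_Icc_iff.1 hx)) (fun _ _ => rfl) y).1 h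

/-- Integration by parts in θ: the boundary terms cancel by periodicity, and the kernel reproduces
the resulting sine with the factor r ^ n. -/
lemma integral_kernelDeriv_mul_cos {r : ℝ} (hr : r ∈ Ico (0 : ℝ) 1) (φ : ℝ) (n : ℕ) :
    ∫ θ in -π..π, cos (n * θ) * kernelDeriv r (φ - θ) = -(n * r ^ n * sin (n * φ)) := by
  have hk := continuous_kernelDeriv hr
  have hv : ∀ θ, HasDerivAt (fun θ => kernel r (φ - θ)) (-kernelDeriv r (φ - θ)) θ := fun θ =>
    (hasDerivAt_kernel hr (φ - θ)).comp_const_sub φ θ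
  have hu : ∀ θ : ℝ, HasDerivAt (fun θ => cos (n * θ)) (-(n * sin (n * θ))) θ := fun θ => by
    have h1 : HasDerivAt (fun θ : ℝ => n * θ) n θ := by
      simpa using (hasDerivAt_id θ).const_mul (n : ℝ)
    exact ((hasDerivAt_cos _).comp θ h1).congr_deriv (by ring)
  have key := intervalIntegral.integral_mul_deriv_eq_deriv_mul (a := -π) (b := π)
    (fun x _ => hu x) (fun x _ => hv x)
    (Continuous.intervalIntegrable (by fun_prop) _ _) (Continuous.intervalIntegrable (by fun_prop) _ _)
  have e1 : kernel r (φ - -π) = kernel r (φ - π) := by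
    rw [← kernel_periodic r (φ - π)]; ring_nf
  have e2 : cos (n * -π) = cos (n * π) := by rw [mul_neg, cos_neg]
  have e3 : ∀ x, -(n * sin (n * x)) * kernel r (φ - x) = -n * (kernel r (x - φ) * sin (n * x)) := by
    intro x
    have : kernel r (φ - x) = kernel r (x - φ) := by
      rw [← neg_sub]; simp only [kernel, cos_neg]
    rw [this]; ring
  rw [e1, e2, sub_self, zero_sub] at key
  simp_rw [e3] at key
  rw [intervalIntegral.integral_const_mul, integral_kernel_mul_sin hr] at key
  simp_rw [mul_neg] at key
  rw [intervalIntegral.integral_neg] at key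
  linarith

/-- The Fourier cosine coefficients of the Poisson integral of `F'`. -/
lemma integral_cos_mul_poissonDeriv {F : ℝ → ℝ} (hF : Continuous F) (h0 : F π = F (-π)) {r : ℝ}
    (hr : r ∈ Ico (0 : ℝ) 1) (n : ℕ) :
    ∫ θ in -π..π, cos (n * θ) * poissonDeriv F r θ
      = n * r ^ n * ∫ φ in -π..π, F φ * sin (n * φ) := by
  have hk := continuous_kernelDeriv hr
  have hc : Continuous (Function.uncurry fun θ φ => cos (n * θ) * (F φ * kernelDeriv r (φ - θ))) := by
    fun_prop
  have e1 : ∀ θ, cos (n * θ) * poissonDeriv F r θ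
      = -∫ φ in -π..π, cos (n * θ) * (F φ * kernelDeriv r (φ - θ)) := fun θ => by
    rw [poissonDeriv, h0, sub_self, zero_mul, zero_sub, intervalIntegral.integral_const_mul]; ring
  simp_rw [e1]
  rw [intervalIntegral.integral_neg, intervalIntegral_intervalIntegral_swap]
  · have e2 : ∀ φ, ∫ θ in -π..π, cos (n * θ) * (F φ * kernelDeriv r (φ - θ))
        = -(n * r ^ n) * (F φ * sin (n * φ)) := fun φ => by
      simp_rw [mul_left_comm (cos _) (F φ)]
      rw [intervalIntegral.integral_const_mul, integral_kernelDeriv_mul_cos hr]; ring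
    simp_rw [e2]
    rw [intervalIntegral.integral_const_mul]; ring
  · exact (hc.continuousOn.integrableOn_compact (isCompact_uIcc.prod isCompact_uIcc)).mono_set
      (prod_mono uIoc_subset_uIcc uIoc_subset_uIcc)

/-! ### Truncated waves and their superposition -/

/-- The function `x ↦ sin (n x)` on `[0, L]`, constant outside this interval. -/
noncomputable def wave (n : ℕ) (L x : ℝ) : ℝ := sin (n * max 0 (min x L))

lemma continuous_wave (n : ℕ) (L : ℝ) : Continuous (wave n L) := by
  unfold wave; fun_prop

lemma abs_wave_le (n : ℕ) (L x : ℝ) : |wave n L x| ≤ 1 := abs_sin_le_one _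

lemma wave_of_nonpos (n : ℕ) {L x : ℝ} (hx : x ≤ 0) : wave n L x = 0 := by
  rw [wave, max_eq_left ((min_le_left _ _).trans hx)]; simp

lemma wave_of_mem (n : ℕ) {L x : ℝ} (hx : x ∈ Icc 0 L) : wave n L x = sin (n * x) := by
  rw [wave, min_eq_left hx.2, max_eq_right hx.1]

lemma wave_of_ge {n : ℕ} {L x : ℝ} (hL : 0 ≤ L) (hn : sin (n * L) = 0) (hx : L ≤ x) :
    wave n L x = 0 := by
  rw [wave, min_eq_right hx, max_eq_right hL, hn]

/-- The derivative of `wave n L` off the endpoints. -/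
noncomputable def waveDeriv (n : ℕ) (L : ℝ) : ℝ → ℝ :=
  (Ioo 0 L).indicator fun x => n * cos (n * x)

lemma hasDerivAt_wave {n : ℕ} {L x : ℝ} (hL : 0 ≤ L) (hn : sin (n * L) = 0) (hx0 : x ≠ 0)
    (hxL : x ≠ L) : HasDerivAt (wave n L) (waveDeriv n L x) x := by
  rcases lt_or_gt_of_ne hx0 with h | h
  · rw [waveDeriv, indicator_of_notMem (fun h' => (h'.1.trans h).false)]
    refine (hasDerivAt_const x (0 : ℝ)).congr_of_eventuallyEq ?_
    filter_upwards [Iio_mem_nhds h] with y hy using wave_of_nonpos n (le_of_lt hy)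
  rcases lt_or_gt_of_ne hxL with h' | h'
  · rw [waveDeriv, indicator_of_mem (show x ∈ Ioo 0 L from ⟨h, h'⟩)]
    have h1 : HasDerivAt (fun x : ℝ => n * x) n x := by
      simpa using (hasDerivAt_id x).const_mul (n : ℝ)
    have h2 : HasDerivAt (fun x : ℝ => sin (n * x)) (n * cos (n * x)) x :=
      ((hasDerivAt_sin _).comp x h1).congr_deriv (by ring)
    refine h2.congr_of_eventuallyEq ?_
    filter_upwards [Ioo_mem_nhds h h'] with y hy using wave_of_mem n ⟨hy.1.le, hy.2.le⟩
  · rw [waveDeriv, indicator_of_notMem (fun h'' => (h''.2.trans h').false)]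
    refine (hasDerivAt_const x (0 : ℝ)).congr_of_eventuallyEq ?_
    filter_upwards [Ioi_mem_nhds h'] with y hy using wave_of_ge hL hn (le_of_lt hy)

lemma integral_wave_mul_sin {n : ℕ} {L : ℝ} (hL : 0 ≤ L) (hLpi : L ≤ π) (hn : sin (n * L) = 0)
    (m : ℕ) : ∫ x in -π..π, wave n L x * sin (m * x) = ∫ x in (0 : ℝ)..L, sin (n * x) * sin (m * x) := by
  have hc : Continuous fun x => wave n L x * sin (m * x) :=
    (continuous_wave n L).mul (by fun_prop)
  rw [← intervalIntegral.integral_add_adjacent_intervals (b := 0) (hc.intervalIntegrable _ _)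
    (hc.intervalIntegrable _ _), ← intervalIntegral.integral_add_adjacent_intervals (b := L)
    (hc.intervalIntegrable 0 L) (hc.intervalIntegrable _ _)]
  have e1 : ∫ x in -π..0, wave n L x * sin (m * x) = 0 := by
    refine intervalIntegral.integral_zero_ae (.of_forall fun x hx => ?_)
    rw [uIoc_of_le (by linarith [pi_pos])] at hx
    rw [wave_of_nonpos n hx.2, zero_mul]
  have e2 : ∫ x in L..π, wave n L x * sin (m * x) = 0 := by
    refine intervalIntegral.integral_zero_ae (.of_forall fun x hx => ?_)
    rw [uIoc_of_le hLpi] at hx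
    rw [wave_of_ge hL hn hx.1.le, zero_mul]
  rw [e1, e2, zero_add, add_zero]
  refine intervalIntegral.integral_congr fun x hx => ?_
  rw [uIcc_of_le hL] at hx
  simp only [wave_of_mem n hx]

/-- Product-to-sum gives an antiderivative in sin((n ± m)x), which vanishes at L by the addition
formulas as soon as both sines do. -/
lemma integral_sin_mul_sin_of_ne {n m : ℕ} (hnm : n ≠ m) (hn0 : n ≠ 0) {L : ℝ}
    (hn : sin (n * L) = 0) (hm : sin (m * L) = 0) :
    ∫ x in (0 : ℝ)..L, sin (n * x) * sin (m * x) = 0 := by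
  have h1 : (n : ℝ) - m ≠ 0 := sub_ne_zero.2 (by exact_mod_cast hnm)
  have h2 : (n : ℝ) + m ≠ 0 := by positivity
  have hlin : ∀ c x : ℝ, HasDerivAt (fun x : ℝ => c * x) c x := fun c x => by
    simpa using (hasDerivAt_id x).const_mul c
  have hd : ∀ x : ℝ, HasDerivAt (fun x => sin ((n - m : ℝ) * x) / (2 * (n - m))
      - sin ((n + m : ℝ) * x) / (2 * (n + m))) (sin (n * x) * sin (m * x)) x := by
    intro x
    have a1 := ((hasDerivAt_sin _).comp x (hlin (n - m : ℝ) x)).div_const (2 * (n - m : ℝ))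
    have a2 := ((hasDerivAt_sin _).comp x (hlin (n + m : ℝ) x)).div_const (2 * (n + m : ℝ))
    refine (a1.sub a2).congr_deriv ?_
    rw [sub_mul, add_mul, cos_sub, cos_add]
    field_simp
    ring
  rw [intervalIntegral.integral_eq_sub_of_hasDerivAt (fun x _ => hd x)
    (Continuous.intervalIntegrable (by fun_prop) _ _)]
  rw [sub_mul, add_mul, sin_sub, sin_add, hn, hm]
  simp

lemma integral_sin_mul_sin_self {n : ℕ} (hn0 : n ≠ 0) {L : ℝ} (hn : sin (n * L) = 0) :
    ∫ x in (0 : ℝ)..L, sin (n * x) * sin (n * x) = L / 2 := by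
  have h1 : (n : ℝ) ≠ 0 := by exact_mod_cast hn0
  have hlin : ∀ c x : ℝ, HasDerivAt (fun x : ℝ => c * x) c x := fun c x => by
    simpa using (hasDerivAt_id x).const_mul c
  have hd : ∀ x : ℝ, HasDerivAt (fun x => x / 2 - sin (n * x) * cos (n * x) / (2 * n))
      (sin (n * x) * sin (n * x)) x := by
    intro x
    have a1 := (hasDerivAt_sin _).comp x (hlin (n : ℝ) x)
    have a2 := (hasDerivAt_cos _).comp x (hlin (n : ℝ) x)
    refine (((hasDerivAt_id x).div_const 2).sub ((a1.mul a2).div_const (2 * (n : ℝ)))).congr_deriv ?_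
    simp only [Function.comp_apply]
    field_simp
    linear_combination -(sin_sq_add_cos_sq (n * x))
  rw [intervalIntegral.integral_eq_sub_of_hasDerivAt (fun x _ => hd x)
    (Continuous.intervalIntegrable (by fun_prop) _ _), hn]
  simp

lemma sin_mul_pi_div_two_pow {m k : ℕ} (h : 2 ^ k ∣ m) : sin (m * (π / 2 ^ k)) = 0 := by
  obtain ⟨c, rfl⟩ := h
  rw [← sin_nat_mul_pi c]
  congr 1
  push_cast
  field_simp

lemma pi_div_two_pow_mem (k : ℕ) : 0 < π / 2 ^ k ∧ π / 2 ^ k ≤ π :=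
  ⟨by positivity, div_le_self pi_pos.le (one_le_pow₀ (by norm_num))⟩

/-- A superposition of waves of frequencies `n k` on intervals shrinking to `0`. -/
noncomputable def wavePacket (n : ℕ → ℕ) (x : ℝ) : ℝ :=
  ∑' k, (1 / 8) ^ k * wave (n k) (π / 2 ^ k) x

/-- The derivative of `wavePacket n` off a countable set. -/
noncomputable def wavePacketDeriv (n : ℕ → ℕ) (x : ℝ) : ℝ :=
  ∑' k, (1 / 8) ^ k * waveDeriv (n k) (π / 2 ^ k) x

lemma summable_eighth : Summable fun k : ℕ => (1 / 8 : ℝ) ^ k :=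
  summable_geometric_of_lt_one (by norm_num) (by norm_num)

lemma abs_wavePacket_term_le (n : ℕ → ℕ) (k : ℕ) (x : ℝ) :
    ‖(1 / 8) ^ k * wave (n k) (π / 2 ^ k) x‖ ≤ (1 / 8) ^ k := by
  rw [norm_mul, norm_pow, Real.norm_of_nonneg (by norm_num : (0 : ℝ) ≤ 1 / 8)]
  exact mul_le_of_le_one_right (by positivity) (abs_wave_le _ _ _)

lemma continuous_wavePacket (n : ℕ → ℕ) : Continuous (wavePacket n) :=
  continuous_tsum (fun _ => continuous_const.mul (continuous_wave _ _)) summable_eighth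
    (abs_wavePacket_term_le n)

lemma exists_forall_pi_div_two_pow_lt {x : ℝ} (hx : 0 < x) : ∃ N : ℕ, ∀ k ≥ N, π / 2 ^ k < x := by
  have h : Tendsto (fun k : ℕ => π / 2 ^ k) atTop (𝓝 0) :=
    tendsto_const_nhds.div_atTop (tendsto_pow_atTop_atTop_of_one_lt (by norm_num))
  exact eventually_atTop.1 (h.eventually_lt_const hx)

/-- The supports [0, π/2ᵏ] shrink to 0, so near any x ≠ 0 only finitely many waves are nonzero and
the sum is differentiated term by term, away from the ends of the supports. -/
lemma hasDerivAt_wavePacket {n : ℕ → ℕ} (hn : ∀ k, 2 ^ k ∣ n k) {x : ℝ}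
    (hx : x ∉ insert 0 (range fun k : ℕ => π / 2 ^ k)) :
    HasDerivAt (wavePacket n) (wavePacketDeriv n x) x := by
  simp only [mem_insert_iff, mem_range, not_or, not_exists] at hx
  obtain ⟨N, U, hU, hN⟩ : ∃ N : ℕ, ∃ U ∈ 𝓝 x, ∀ k ∉ Finset.range N, ∀ y ∈ U,
      wave (n k) (π / 2 ^ k) y = 0 ∧ waveDeriv (n k) (π / 2 ^ k) y = 0 := by
    rcases lt_or_gt_of_ne hx.1 with h | h
    · refine ⟨0, Iio 0, Iio_mem_nhds h, fun k _ y hy => ⟨wave_of_nonpos _ (le_of_lt hy), ?_⟩⟩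
      exact indicator_of_notMem (fun h' => (h'.1.trans hy).false) _
    · obtain ⟨N, hN⟩ := exists_forall_pi_div_two_pow_lt (half_pos h)
      refine ⟨N, Ioi (x / 2), Ioi_mem_nhds (half_lt_self h), fun k hk y hy => ?_⟩
      have hk' : π / 2 ^ k < y := (hN k (by simpa using hk)).trans hy
      exact ⟨wave_of_ge (pi_div_two_pow_mem k).1.le (sin_mul_pi_div_two_pow (hn k)) hk'.le,
        indicator_of_notMem (fun h' => (h'.2.trans hk').false) _⟩
  have e1 : wavePacket n =ᶠ[𝓝 x]
      fun y => ∑ k ∈ Finset.range N, (1 / 8) ^ k * wave (n k) (π / 2 ^ k) y := by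
    filter_upwards [hU] with y hy
    exact tsum_eq_sum fun k hk => by rw [(hN k hk y hy).1, mul_zero]
  have e2 : wavePacketDeriv n x
      = ∑ k ∈ Finset.range N, (1 / 8) ^ k * waveDeriv (n k) (π / 2 ^ k) x :=
    tsum_eq_sum fun k hk => by rw [(hN k hk x (mem_of_mem_nhds hU)).2, mul_zero]
  rw [e2]
  refine HasDerivAt.congr_of_eventuallyEq ?_ e1
  exact HasDerivAt.fun_sum fun k _ => (hasDerivAt_wave (pi_div_two_pow_mem k).1.le
    (sin_mul_pi_div_two_pow (hn k)) hx.1 (fun h => hx.2 k h.symm)).const_mul _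

lemma wavePacket_pi {n : ℕ → ℕ} (hn : ∀ k, 2 ^ k ∣ n k) : wavePacket n π = 0 := by
  have : ∀ k, (1 / 8 : ℝ) ^ k * wave (n k) (π / 2 ^ k) π = 0 := fun k => by
    rw [wave_of_ge (pi_div_two_pow_mem k).1.le (sin_mul_pi_div_two_pow (hn k))
      (pi_div_two_pow_mem k).2, mul_zero]
  simp only [wavePacket, this, tsum_zero]

lemma wavePacket_neg_pi (n : ℕ → ℕ) : wavePacket n (-π) = 0 := by
  simp only [wavePacket, wave_of_nonpos _ (neg_nonpos.2 pi_pos.le), mul_zero, tsum_zero]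

lemma wavePacketDeriv_eq_zero (n : ℕ → ℕ) {x : ℝ} (hx : x ∉ Ioo 0 π) :
    wavePacketDeriv n x = 0 := by
  have : ∀ k, waveDeriv (n k) (π / 2 ^ k) x = 0 := fun k =>
    indicator_of_notMem (fun h => hx ⟨h.1, h.2.trans_le (pi_div_two_pow_mem k).2⟩) _
  simp only [wavePacketDeriv, this, mul_zero, tsum_zero]

/-- Tags range over the closed interval, so the endpoint -π counts as well; there the periodization
takes the value at π, and both values are 0. -/
lemma periodize_wavePacketDeriv_eq (n : ℕ → ℕ) {x : ℝ} (hx : x ∈ Icc (-π) π) :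
    periodize (wavePacketDeriv n) x = wavePacketDeriv n x := by
  rcases hx.1.eq_or_lt with h | h
  · have h1 : periodize (wavePacketDeriv n) x = periodize (wavePacketDeriv n) π := by
      rw [← periodize_periodic _ x, ← h]; congr 1; ring
    rw [h1, periodize_eq _ ⟨by linarith [pi_pos], le_rfl⟩,
      wavePacketDeriv_eq_zero n (fun h' => h'.2.false),
      wavePacketDeriv_eq_zero n (fun h' => by linarith [h'.1, pi_pos])]
  · exact periodize_eq _ ⟨h, hx.2⟩

lemma countable_insert_zero_range : (insert 0 (range fun k : ℕ => π / 2 ^ k)).Countable :=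
  (countable_range _).insert _

lemma periodize_wavePacketDeriv_mem_HK {n : ℕ → ℕ} (hn : ∀ k, 2 ^ k ∣ n k) :
    periodize (wavePacketDeriv n) ∈ HK :=
  ⟨periodize_periodic _, ((hasHK_of_hasDerivAt (continuous_wavePacket n)
    countable_insert_zero_range fun _ hx => hasDerivAt_wavePacket hn hx).congr
      fun _ hx => (periodize_wavePacketDeriv_eq n hx).symm).integrable⟩

lemma poisson_periodize_wavePacketDeriv {n : ℕ → ℕ} (hn : ∀ k, 2 ^ k ∣ n k) {r : ℝ}
    (hr : r ∈ Ico (0 : ℝ) 1) :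
    poisson (periodize (wavePacketDeriv n)) r = poissonDeriv (wavePacket n) r := by
  ext θ
  rw [poissonDeriv_eq]
  have h := hasHK_mul_of_hasDerivAt (continuous_wavePacket n)
    countable_insert_zero_range (fun _ hx => hasDerivAt_wavePacket hn hx)
    (hasDerivAt_kernel_sub hr θ) (continuous_kernelDeriv_sub hr θ)
  refine (h.congr (g := fun φ => periodize (wavePacketDeriv n) φ * kernel r (φ - θ))
    fun x hx => ?_).integral_eq
  simp only [periodize_wavePacketDeriv_eq n hx]

/-- The sine coefficient of `wavePacket n` of order `n j` is not small. -/
lemma le_integral_wavePacket_mul_sin {n : ℕ → ℕ} (hn : ∀ k, 2 ^ k ∣ n k) (hmono : StrictMono n)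
    (hpos : ∀ k, n k ≠ 0) (j : ℕ) :
    (1 / 16) ^ j ≤ ∫ x in -π..π, wavePacket n x * sin (n j * x) := by
  set c : ℕ → ℝ := fun k =>
    ∫ x in -π..π, (1 / 8) ^ k * wave (n k) (π / 2 ^ k) x * sin (n j * x) with hc
  have hsum : HasSum c (∫ x in -π..π, wavePacket n x * sin (n j * x)) := by
    refine intervalIntegral.hasSum_integral_of_dominated_convergence
      (fun k _ => (1 / 8) ^ k) (fun k => ?_) (fun k => .of_forall fun x _ => ?_)
      (.of_forall fun _ _ => summable_eighth) intervalIntegrable_const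
      (.of_forall fun x _ => ?_)
    · have := continuous_wave (n k) (π / 2 ^ k)
      exact Continuous.aestronglyMeasurable (by fun_prop)
    · rw [norm_mul]
      exact (mul_le_of_le_one_right (norm_nonneg _) (abs_sin_le_one _)).trans
        (abs_wavePacket_term_le n k x)
    · exact ((summable_eighth.of_norm_bounded fun k =>
        abs_wavePacket_term_le n k x).hasSum).mul_right _
  have hterm : ∀ k, c k = (1 / 8) ^ k * ∫ x in (0 : ℝ)..π / 2 ^ k, sin (n k * x) * sin (n j * x) := by
    intro k
    rw [← integral_wave_mul_sin (pi_div_two_pow_mem k).1.le (pi_div_two_pow_mem k).2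
      (sin_mul_pi_div_two_pow (hn k)), ← intervalIntegral.integral_const_mul]
    simp only [hc, mul_assoc]
  -- For k < j, 2ᵏ divides n j too, so sin(n j · x) vanishes at π/2ᵏ and orthogonality applies.
  have hlt : ∀ k < j, c k = 0 := by
    intro k hk
    rw [hterm, integral_sin_mul_sin_of_ne (hmono hk).ne (hpos k) (sin_mul_pi_div_two_pow (hn k))
      (sin_mul_pi_div_two_pow ((pow_dvd_pow 2 hk.le).trans (hn j))), mul_zero]
  have hpow : ∀ k : ℕ, (1 / 8 : ℝ) ^ k * (π / 2 ^ k) = π * (1 / 16) ^ k := by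
    intro k
    rw [show (1 / 16 : ℝ) = 1 / 8 * (1 / 2) by norm_num, mul_pow, one_div_pow 2 k]
    field_simp
  have heq : c j = π / 2 * (1 / 16) ^ j := by
    rw [hterm, integral_sin_mul_sin_self (hpos j) (sin_mul_pi_div_two_pow (hn j))]
    linarith [hpow j]
  have hge : ∀ k, ‖c k‖ ≤ π * (1 / 16) ^ k := by
    intro k
    rw [hterm, norm_mul, ← hpow, Real.norm_of_nonneg (by positivity)]
    refine mul_le_mul_of_nonneg_left ?_ (by positivity)
    have := intervalIntegral.norm_integral_le_of_norm_le_const (a := 0) (b := π / 2 ^ k)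
      (f := fun x => sin (n k * x) * sin (n j * x)) (C := 1) fun x _ => by
        rw [norm_mul]
        exact mul_le_one₀ (abs_sin_le_one _) (norm_nonneg _) (abs_sin_le_one _)
    rwa [sub_zero, abs_of_pos (pi_div_two_pow_mem k).1, one_mul] at this
  -- The later waves are estimated trivially: their sum is at most (π/15) 16⁻ʲ against the main term
  -- (π/2) 16⁻ʲ, and π(1/2 - 1/15) > 1.
  have htail : ‖∑' k, c (k + (j + 1))‖ ≤ π * (1 / 16) ^ (j + 1) * (16 / 15) := by
    have hg : HasSum (fun k : ℕ => π * (1 / 16) ^ (j + 1) * (1 / 16 : ℝ) ^ k)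
        (π * (1 / 16) ^ (j + 1) * (16 / 15)) := by
      have := (hasSum_geometric_of_lt_one (r := (1 / 16 : ℝ)) (by norm_num) (by norm_num)).mul_left
        (π * (1 / 16) ^ (j + 1))
      rwa [show (1 - 1 / 16 : ℝ)⁻¹ = 16 / 15 by norm_num] at this
    refine tsum_of_norm_bounded hg fun k => (hge _).trans_eq ?_
    rw [pow_add]; ring
  rw [← hsum.tsum_eq, ← hsum.summable.sum_add_tsum_nat_add (j + 1), Finset.sum_range_succ,
    Finset.sum_eq_zero fun k hk => hlt k (Finset.mem_range.1 hk), zero_add, heq]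
  have h1 := (abs_le.1 htail).1
  rw [pow_succ] at h1
  have h2 : (0 : ℝ) < (1 / 16) ^ j := by positivity
  nlinarith [pi_gt_three]

/-- Bernoulli's inequality: at radius 1 - 1/(2n) the n-th harmonic loses at most half its size. -/
lemma half_le_one_sub_pow {n : ℕ} (hn : n ≠ 0) : (1 : ℝ) / 2 ≤ (1 - 1 / (2 * n)) ^ n := by
  have hn' : (1 : ℝ) ≤ n := by exact_mod_cast Nat.one_le_iff_ne_zero.2 hn
  have h1 : (1 : ℝ) / (2 * n) ≤ 1 := by rw [div_le_one (by positivity)]; linarith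
  have := one_add_mul_le_pow (a := -(1 / (2 * n) : ℝ)) (by linarith) n
  rw [← sub_eq_add_neg] at this
  refine le_trans (le_of_eq ?_) this
  field_simp
  norm_num

lemma one_sub_mem_Ico {n : ℕ} (hn : n ≠ 0) : (1 - 1 / (2 * n) : ℝ) ∈ Ico (0 : ℝ) 1 := by
  have hn' : (1 : ℝ) ≤ n := by exact_mod_cast Nat.one_le_iff_ne_zero.2 hn
  have h1 : (1 : ℝ) / (2 * n) ≤ 1 := by rw [div_le_one (by positivity)]; linarith
  have h2 : (0 : ℝ) < 1 / (2 * n) := by positivity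
  exact ⟨by linarith, by linarith⟩

/-! ### Sharpness of the norm estimate -/

/-- A trigonometric moment is bounded by the `Lᵖ` norm. -/
lemma exists_abs_integral_cos_mul_le {p : ENNReal} (hp : 1 ≤ p) :
    ∃ K > 0, ∀ (u : ℝ → ℝ), Continuous u → MemLp u p circleMeasure → ∀ n : ℕ,
      |∫ θ in -π..π, cos (n * θ) * u θ| ≤ K * (eLpNorm u p circleMeasure).toReal := by
  set e : ℝ := 1 / (1 : ENNReal).toReal - 1 / p.toReal with he
  have he0 : 0 ≤ e := by
    simp only [he, ENNReal.toReal_one, div_one, sub_nonneg]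
    by_cases h : p = ⊤
    · simp [h]
    · have : (1 : ℝ) ≤ p.toReal := by
        rw [← ENNReal.toReal_one]; exact ENNReal.toReal_mono h hp
      exact div_le_one_of_le₀ this (by positivity)
  have hfin : circleMeasure univ ^ e ≠ ⊤ :=
    ENNReal.rpow_ne_top_of_nonneg he0 (measure_ne_top _ _)
  refine ⟨(circleMeasure univ ^ e).toReal + 1, by positivity, fun u hu hup n => ?_⟩
  have hpi : -π ≤ π := by linarith [pi_pos]
  have h1 : |∫ θ in -π..π, cos (n * θ) * u θ| ≤ ∫ θ, ‖u θ‖ ∂circleMeasure := by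
    rw [intervalIntegral.integral_of_le hpi]
    refine norm_integral_le_of_norm_le (f := fun θ => cos (n * θ) * u θ)
      (hup.integrable hp).norm (.of_forall fun θ => ?_)
    rw [norm_mul]
    exact mul_le_of_le_one_left (norm_nonneg _) (abs_cos_le_one _)
  have h2 : ∫ θ, ‖u θ‖ ∂circleMeasure = (eLpNorm u 1 circleMeasure).toReal := by
    rw [eLpNorm_one_eq_lintegral_enorm, integral_norm_eq_lintegral_enorm
      hu.aestronglyMeasurable]
  have h3 := ENNReal.toReal_mono (ENNReal.mul_ne_top hup.eLpNorm_ne_top hfin)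
    (eLpNorm_le_eLpNorm_mul_rpow_measure_univ hp (μ := circleMeasure) hu.aestronglyMeasurable)
  rw [ENNReal.toReal_mul] at h3
  rw [h2] at h1
  nlinarith [ENNReal.toReal_nonneg (a := eLpNorm u p circleMeasure)]

/-- At r = 1 - 1/(2n) one has 1/(1-r) = 2n, so the hypothesis gives the bound for all large n, and
multiples of 2ᵏ occur arbitrarily far out. -/
lemma exists_frequencies {ψ : ℝ → ℝ} (ho : ψ =o[𝓝[<] 1] (fun r : ℝ => 1 / (1 - r))) :
    ∃ n : ℕ → ℕ, StrictMono n ∧ ∀ k, n k ≠ 0 ∧ 2 ^ k ∣ n k ∧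
      ψ (1 - 1 / (2 * n k)) ≤ n k * (1 / 16) ^ k := by
  have ht : Tendsto (fun n : ℕ => (1 - 1 / (2 * n) : ℝ)) atTop (𝓝[<] 1) := by
    refine tendsto_nhdsWithin_iff.2 ⟨?_, ?_⟩
    · have : Tendsto (fun n : ℕ => 1 / (2 * n : ℝ)) atTop (𝓝 0) :=
        tendsto_const_nhds.div_atTop
          (tendsto_natCast_atTop_atTop.const_mul_atTop (by norm_num))
      simpa using this.const_sub 1
    · filter_upwards [eventually_ne_atTop 0] with n hn using (one_sub_mem_Ico hn).2
  refine extraction_forall_of_frequently (P := fun k n => n ≠ 0 ∧ 2 ^ k ∣ n ∧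
    ψ (1 - 1 / (2 * n)) ≤ n * (1 / 16) ^ k) fun k => ?_
  have h1 : ∀ᶠ n : ℕ in atTop, ψ (1 - 1 / (2 * n)) ≤ n * (1 / 16) ^ k := by
    filter_upwards [ht.eventually (ho.def (c := (1 / 16) ^ k / 2) (by positivity))] with n hn
    refine (le_abs_self _).trans (hn.trans_eq ?_)
    rw [sub_sub_cancel, one_div_one_div, Real.norm_of_nonneg (by positivity)]
    ring
  have h2 : ∃ᶠ n : ℕ in atTop, 2 ^ k ∣ n :=
    frequently_atTop.2 fun a => ⟨2 ^ k * a, Nat.le_mul_of_pos_left a (by positivity), dvd_mul_right _ _⟩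
  exact (h2.and_eventually (h1.and (eventually_ne_atTop 0))).mono fun n h => ⟨h.2.2, h.1, h.2.1⟩

/-- At r = 1 - 1/(2 n_k) the n_k-th cosine moment is at least n_k 16⁻ᵏ/2 ≥ ψ(r)/2, while it is at
most K‖u_r‖_p. Hence ‖u_r‖_p ≥ ψ(r)/(2K) along these radii, against half that constant from the
little-o assumption. -/
theorem exists_eLpNorm_not_isLittleO {p : ENNReal} (hp : 1 ≤ p) {ψ : ℝ → ℝ}
    (hψ : ∀ r ∈ Ico (0 : ℝ) 1, 0 < ψ r) (ho : ψ =o[𝓝[<] 1] (fun r : ℝ => 1 / (1 - r))) :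
    ∃ f ∈ HK, ¬ (fun r : ℝ => (eLpNorm (poisson f r) p circleMeasure).toReal) =o[𝓝[<] 1] ψ := by
  obtain ⟨n, hmono, hn⟩ := exists_frequencies ho
  have hdiv : ∀ k, 2 ^ k ∣ n k := fun k => (hn k).2.1
  have hmem := periodize_wavePacketDeriv_mem_HK hdiv
  refine ⟨periodize (wavePacketDeriv n), hmem, fun hcon => ?_⟩
  obtain ⟨K, hK, hKu⟩ := exists_abs_integral_cos_mul_le hp
  have hseq : Tendsto (fun k => (1 - 1 / (2 * n k) : ℝ)) atTop (𝓝[<] 1) := by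
    refine tendsto_nhdsWithin_iff.2 ⟨?_, .of_forall fun k => (one_sub_mem_Ico (hn k).1).2⟩
    have : Tendsto (fun k : ℕ => 1 / (2 * n k : ℝ)) atTop (𝓝 0) :=
      tendsto_const_nhds.div_atTop ((tendsto_natCast_atTop_atTop.comp
        hmono.tendsto_atTop).const_mul_atTop (by norm_num))
    simpa using this.const_sub 1
  obtain ⟨k, hk⟩ := (hseq.eventually (hcon.def (c := 1 / (4 * K)) (by positivity))).exists
  have hr := one_sub_mem_Ico (hn k).1
  set r : ℝ := 1 - 1 / (2 * n k) with hrdef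
  rw [Real.norm_of_nonneg ENNReal.toReal_nonneg, Real.norm_of_nonneg (hψ r hr).le] at hk
  have h1 := hKu _ (continuous_poisson hmem.2 hr) (memLp_poisson hmem.2 p hr) (n k)
  have h2 := integral_cos_mul_poissonDeriv (continuous_wavePacket n)
    (by rw [wavePacket_pi hdiv, wavePacket_neg_pi]) hr (n k)
  rw [← poisson_periodize_wavePacketDeriv hdiv hr] at h2
  rw [h2] at h1
  have h3 := le_integral_wavePacket_mul_sin hdiv hmono (fun k => (hn k).1) k
  have h4 : (1 : ℝ) / 2 ≤ r ^ n k := half_le_one_sub_pow (hn k).1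
  have hnk : (0 : ℝ) < n k := by exact_mod_cast Nat.pos_of_ne_zero (hn k).1
  have h5 : n k * (1 / 2) * (1 / 16) ^ k
      ≤ n k * r ^ n k * ∫ x in -π..π, wavePacket n x * sin (n k * x) :=
    mul_le_mul (mul_le_mul_of_nonneg_left h4 hnk.le) h3 (by positivity)
      (mul_nonneg hnk.le (le_trans (by norm_num) h4))
  have h6 : K * (eLpNorm (poisson (periodize (wavePacketDeriv n)) r) p circleMeasure).toReal
      ≤ 1 / 4 * (n k * (1 / 16) ^ k) := by
    calc _ ≤ K * (1 / (4 * K) * ψ r) := mul_le_mul_of_nonneg_left hk hK.le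
      _ = 1 / 4 * ψ r := by field_simp
      _ ≤ _ := mul_le_mul_of_nonneg_left (hn k).2.2 (by norm_num)
  have h7 : 0 < n k * (1 / 16 : ℝ) ^ k := by positivity
  linarith [(h5.trans (le_abs_self _)).trans (h1.trans h6)]

end HKPoisson

/-! ### The assembled theorem -/

theorem theorem1 :
    -- the Poisson integral of a function in `HK` exists at every point of the disc
    (∀ f ∈ HKPoisson.HK, ∀ r ∈ Ico (0 : ℝ) 1, ∀ θ : ℝ,
      HKPoisson.HKIntegrable (fun φ => f φ * HKPoisson.kernel r (φ - θ))) ∧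
    -- (a), the estimate: the supremum is finite and is `o(1/(1-r))`
    (∀ f ∈ HKPoisson.HK,
      (∀ r ∈ Ico (0 : ℝ) 1,
        BddAbove (range fun θ : Icc (-π) π => |HKPoisson.poisson f r θ|)) ∧
      (fun r : ℝ => ⨆ θ : Icc (-π) π, |HKPoisson.poisson f r θ|)
        =o[𝓝[<] 1] fun r : ℝ => 1 / (1 - r)) ∧
    -- (a), sharpness: for functions on the disc, `o` as `r → 1` is uniform in `θ`
    (∀ ψ : ℂ → ℝ, (∀ z ∈ Metric.ball (0 : ℂ) 1, 0 < ψ z) →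
      (fun q : ℝ × ℝ => ψ (q.1 * Complex.exp (q.2 * Complex.I)))
        =o[𝓝[<] 1 ×ˢ ⊤] (fun q : ℝ × ℝ => 1 / (1 - q.1)) →
      ∃ f ∈ HKPoisson.HK, Integrable f HKPoisson.circleMeasure ∧
        ¬ (fun q : ℝ × ℝ => HKPoisson.poisson f q.1 q.2)
          =o[𝓝[<] 1 ×ˢ ⊤] fun q : ℝ × ℝ => ψ (q.1 * Complex.exp (q.2 * Complex.I))) ∧
    -- (b)
    (∀ p : ENNReal, 1 ≤ p → p ≠ ⊤ →
      -- the estimate: the norm is finite and is `o(1/(1-r))`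
      (∀ f ∈ HKPoisson.HK,
        (∀ r ∈ Ico (0 : ℝ) 1, MemLp (HKPoisson.poisson f r) p HKPoisson.circleMeasure) ∧
        (fun r : ℝ => (eLpNorm (HKPoisson.poisson f r) p HKPoisson.circleMeasure).toReal)
          =o[𝓝[<] 1] fun r : ℝ => 1 / (1 - r)) ∧
      -- sharpness
      (∀ ψ : ℝ → ℝ, (∀ r ∈ Ico (0 : ℝ) 1, 0 < ψ r) →
        ψ =o[𝓝[<] 1] (fun r : ℝ => 1 / (1 - r)) →
        ∃ f ∈ HKPoisson.HK,
          ¬ (fun r : ℝ => (eLpNorm (HKPoisson.poisson f r) p HKPoisson.circleMeasure).toReal)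
            =o[𝓝[<] 1] ψ)) := by
  refine ⟨fun f hf r hr θ => ?_, fun f hf => ⟨fun r hr => ?_, HKPoisson.iSup_abs_poisson_isLittleO hf.2⟩,
    HKPoisson.exists_integrable_not_isLittleO, fun p hp _ => ⟨fun f hf =>
      ⟨fun r hr => HKPoisson.memLp_poisson hf.2 p hr, HKPoisson.eLpNorm_poisson_isLittleO hf.2 p⟩,
      fun _ hψ ho => HKPoisson.exists_eLpNorm_not_isLittleO hp hψ ho⟩⟩
  · obtain ⟨F, -, H⟩ := HKPoisson.exists_hasHK_poisson hf.2
    exact (H r hr θ).integrable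
  · obtain ⟨C, hC⟩ := HKPoisson.exists_abs_poisson_le hf.2 hr
    exact ⟨C, forall_mem_range.2 fun θ => hC θ⟩
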